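/- Let $m>0$ be real and let $H^m=H^m(\Delta)$ be the Fréchet space of holomorphic differentials $f(z)(dz)^m$, $f=\sum_{n\ge 0} f_nz^n$ holomorphic on the unit disk $\Delta$, with the topology of uniform convergence on compact sets and its Borel structure. Let $\tilde G$ be the universal covering of $PSU(1,1)$, realized as the set of triples $(a,b,A)\in\mathbb C^3$ with $|a|^2-|b|^2=1$, $e^A=a$; it acts on $H^m$ by $$f(z)(dz)^m\mapsto f\Big(\frac{\bar a z-b}{-\bar b z+a}\Big)(a-\bar b z)^{-2m}(dz)^m,\qquad (a-\bar bz)^{-2m}:=e^{-2mA}\Big(1-\frac{\bar b}{a}z\Big)^{-2m}$$ (principal branch). Let $H^m\cap L^2\subset H^m$ be the Hilbert space with norm $|f|^2=\sum_n w_n|f_n|^2$, $w_n=\frac{\Gamma(n+1)\Gamma(2m)}{\Gamma(2m+n)}$, and let $(H^m\cap L^2)^*$ be the space of its bounded complex-linear functionals. Given a Borel probability measure $\mu$ on $H^m$ and $\phi\in(H^m\cap L^2)^*$, regard $\phi$ as the random variable on $(H^m,\mu)$ given by $\phi(f)=\lim_{N\to\infty}\phi\big(\sum_{n<N}f_nz^n(dz)^m\big)$,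 the limit being taken in $\mu$-probability; if the limit exists, $\phi_*\mu$ denotes its law on $\mathbb C$. (If $\phi$ extends continuously to $H^m$, this is the usual image measure.) The variance of a complex random variable $X$ is normalized per real dimension, $\frac12\big(\mathrm{Var}(\mathrm{Re}X)+\mathrm{Var}(\mathrm{Im}X)\big)$, so that the Gaussian $\frac1{2\pi\sigma^2}e^{-|z|^2/2\sigma^2}dm(z)$ has variance $\sigma^2$. For $T\ge0$ let $\nu^{(m)}_T$ be the Gaussian measure on $H^m$ under which the Taylor coefficients $f_n$ are independent with laws $\frac{w_n}{2\pi T}e^{-w_n|f_n|^2/2T}dm(f_n)$ (and $\nu_0^{(m)}=\delta_0$). **Proposition.** Let $\nu$ be a $\tilde G$-invariant Borel probability measure on $H^m$, $m>0$, such that for each $\phi\in(H^m\cap L^2)^*$ for which $\phi_*\nu$ is defined, $\phi_*\nu$ has finite variance, in the sense of a finite second moment. Then $\phi_*\nu$ is defined for every $\phi\in(H^m\cap L^2)^*$, and there is $T\in[0,\infty)$ such that (a) the variance of $\phi_*\nu$ equals $T$ for every $\phi\in(H^m\cap L^2)^*$ with $|\phi|=1$; (b) the measure $\nu_T^{(m)}$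 exists as a probability measure on $H^m$, and the scaled $n$-fold convolutions $\nu_n(E)=\nu^{*n}(\sqrt n\,E)$ converge weakly to $\nu^{(m)}_T$ as $n\to\infty$, as Borel probability measures on $H^m$. Moreover, for every $\phi\in(H^m\cap L^2)^*$ the laws $\phi_*\nu_n$ and $\phi_*\nu^{(m)}_T$ are defined and $\phi_*\nu_n\to\phi_*\nu_T^{(m)}$ weakly on $\mathbb C$. -/

import Mathlib

open MeasureTheory ProbabilityTheory Filter Topology
open scoped NNReal ComplexConjugate

noncomputable section

namespace HolDiff

/-- The open unit disc `Δ`, as a type. -/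
abbrev Disc : Type := Metric.ball (0 : ℂ) 1

instance : LocallyCompactSpace Disc := Metric.isOpen_ball.locallyCompactSpace

open Classical in
/-- The extension by zero to `ℂ` of a function on the disc. -/
def extend (f : C(Disc, ℂ)) : ℂ → ℂ :=
  fun z => if h : z ∈ Metric.ball (0 : ℂ) 1 then f ⟨z, h⟩ else 0

lemma extend_coe (f : C(Disc, ℂ)) (z : Disc) : extend f z = f z := by
  simp [extend]

lemma extend_add (f g : C(Disc, ℂ)) : extend (f + g) = extend f + extend g := by
  funext z
  by_cases h : z ∈ Metric.ball (0 : ℂ) 1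
  · simp only [extend, dif_pos h, Pi.add_apply, ContinuousMap.add_apply]
  · simp only [extend, dif_neg h, Pi.add_apply, add_zero]

lemma extend_smul (c : ℂ) (f : C(Disc, ℂ)) : extend (c • f) = c • extend f := by
  funext z
  by_cases h : z ∈ Metric.ball (0 : ℂ) 1
  · simp only [extend, dif_pos h, Pi.smul_apply, ContinuousMap.smul_apply]
  · simp only [extend, dif_neg h, Pi.smul_apply, smul_zero]

/-- Holomorphic functions on the disc. -/
def holSubmodule : Submodule ℂ C(Disc, ℂ) where
  carrier := {f | DifferentiableOn ℂ (extend f) (Metric.ball 0 1)}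
  add_mem' {f g} hf hg := by
    change DifferentiableOn ℂ (extend (f + g)) _
    rw [extend_add]
    exact DifferentiableOn.add hf hg
  zero_mem' := by
    change DifferentiableOn ℂ (extend 0) _
    have : extend 0 = fun _ => (0 : ℂ) := by
      funext z
      simp [extend]
    rw [this]
    exact differentiableOn_const 0
  smul_mem' c f hf := by
    change DifferentiableOn ℂ (extend (c • f)) _
    rw [extend_smul]
    exact DifferentiableOn.const_smul hf c

/-- The Fréchet space `H^m(Δ)` of holomorphic differentials `f(z)(dz)^m` of degree `m` on the disc.
The differential `f(z)(dz)^m` is recorded by the function `f`, so the space itself does not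
depend on `m`; the degree enters through the group action `act` and the Hilbert norm of `HL2`.
The topology is the compact-open one (uniform convergence on compact sets). -/
def Hol : Type := holSubmodule

namespace Hol

instance : AddCommGroup Hol := Submodule.addCommGroup holSubmodule

instance : Module ℂ Hol := Submodule.module holSubmodule

instance : TopologicalSpace Hol := instTopologicalSpaceSubtype

instance : IsTopologicalAddGroup Hol := Submodule.topologicalAddGroup holSubmodule

instance : ContinuousSMul ℂ Hol := SMulMemClass.continuousSMul holSubmodule

instance : SecondCountableTopology Hol := TopologicalSpace.Subtype.secondCountableTopology _

instance : T2Space Hol := inferInstanceAs (T2Space (holSubmodule : Set C(Disc, ℂ)))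

end Hol

instance : MeasurableSpace Hol := borel Hol

instance : BorelSpace Hol := ⟨rfl⟩

/-- Build an element of `Hol` from a function holomorphic on the disc. -/
def Hol.mk (F : ℂ → ℂ) (hF : DifferentiableOn ℂ F (Metric.ball 0 1)) : Hol :=
  ⟨⟨fun z : Disc => F z, hF.continuousOn.domRestrict⟩,
    hF.congr fun z hz => by simp only [extend, dif_pos hz]; rfl⟩

/-- The `n`-th Taylor coefficient at `0`: `f(z) = ∑ f_n z^n`. -/
def coeff (f : Hol) (n : ℕ) : ℂ := iteratedDeriv n (extend f.1) 0 / (n.factorial : ℂ)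

/-- The monomial `z ^ n`. -/
def monomial (n : ℕ) : Hol := Hol.mk (fun z => z ^ n) (differentiable_pow n).differentiableOn

/-! ### The universal covering group of `PSU(1,1)` and its action -/

/-- Elements of the universal covering of `PSU(1,1)`: matrices `(a b; conj b conj a)` with
`|a|² - |b|² = 1`, together with a choice `A` of a logarithm of `a`. -/
structure GTilde where
  a : ℂ
  b : ℂ
  A : ℂ
  det_eq : ‖a‖ ^ 2 - ‖b‖ ^ 2 = 1
  exp_eq : Complex.exp A = a

namespace GTilde

variable (g : GTilde)

lemma a_ne_zero : g.a ≠ 0 := by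
  intro h
  have := g.det_eq
  rw [h] at this
  norm_num at this
  nlinarith [sq_nonneg ‖g.b‖]

lemma norm_b_lt : ‖g.b‖ < ‖g.a‖ := by
  have := g.det_eq
  exact lt_of_pow_lt_pow_left₀ 2 (norm_nonneg _) (by linarith)

lemma norm_bz_lt {z : ℂ} (hz : ‖z‖ < 1) : ‖conj g.b / g.a * z‖ < 1 := by
  have ha : 0 < ‖g.a‖ := norm_pos_iff.2 g.a_ne_zero
  rw [norm_mul, norm_div, RCLike.norm_conj]
  have h1 : ‖g.b‖ / ‖g.a‖ < 1 := (div_lt_one ha).2 g.norm_b_lt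
  have h2 : 0 ≤ ‖g.b‖ / ‖g.a‖ := by positivity
  nlinarith [norm_nonneg z]

lemma one_sub_mem_slitPlane {z : ℂ} (hz : ‖z‖ < 1) :
    1 - conj g.b / g.a * z ∈ Complex.slitPlane := by
  left
  have h1 := g.norm_bz_lt hz
  have h2 := Complex.re_le_norm (conj g.b / g.a * z)
  rw [Complex.sub_re, Complex.one_re]
  linarith

lemma denom_eq (z : ℂ) : -conj g.b * z + g.a = g.a * (1 - conj g.b / g.a * z) := by
  have := g.a_ne_zero
  field_simp
  ring

lemma denom_ne_zero {z : ℂ} (hz : ‖z‖ < 1) : -conj g.b * z + g.a ≠ 0 := by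
  rw [denom_eq]
  exact mul_ne_zero g.a_ne_zero (Complex.slitPlane_ne_zero (g.one_sub_mem_slitPlane hz))

/-- The Möbius transformation by which the inverse of `g` acts on the disc. -/
def mobInv (z : ℂ) : ℂ := (conj g.a * z - g.b) / (-conj g.b * z + g.a)

lemma mobInv_mem {z : ℂ} (hz : z ∈ Metric.ball (0 : ℂ) 1) :
    g.mobInv z ∈ Metric.ball (0 : ℂ) 1 := by
  rw [mem_ball_zero_iff] at hz ⊢
  have hd := g.denom_ne_zero hz
  rw [mobInv, norm_div, div_lt_one (norm_pos_iff.2 hd)]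
  refine lt_of_pow_lt_pow_left₀ 2 (norm_nonneg _) ?_
  have h := g.det_eq
  have hz2 : ‖z‖ ^ 2 < 1 := by nlinarith [norm_nonneg z]
  rw [Complex.sq_norm, Complex.sq_norm, Complex.normSq_apply, Complex.normSq_apply] at *
  simp only [Complex.sub_re, Complex.mul_re, Complex.conj_re, Complex.conj_im, Complex.sub_im,
    Complex.mul_im, Complex.add_re, Complex.add_im, Complex.neg_re, Complex.neg_im]
  nlinarith

end GTilde

/-- The holomorphic branch of `(a - conj b z)^(-2m)` on the disc determined by `A`. -/
def automorphy (m : ℝ) (g : GTilde) (z : ℂ) : ℂ :=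
  Complex.exp (-2 * m * g.A) * (1 - conj g.b / g.a * z) ^ (-2 * m : ℂ)

lemma differentiableOn_act (m : ℝ) (g : GTilde) (f : Hol) :
    DifferentiableOn ℂ (fun z => extend f.1 (g.mobInv z) * automorphy m g z)
      (Metric.ball 0 1) := by
  refine DifferentiableOn.mul ?_ ?_
  · refine DifferentiableOn.comp (g := extend f.1) (f := g.mobInv) f.2 ?_
      fun z hz => g.mobInv_mem hz
    refine DifferentiableOn.div (by fun_prop) (by fun_prop) fun z hz => ?_
    exact g.denom_ne_zero (mem_ball_zero_iff.1 hz)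
  · refine DifferentiableOn.const_mul ?_ _
    refine DifferentiableOn.cpow (by fun_prop) (by fun_prop) fun z hz => ?_
    exact g.one_sub_mem_slitPlane (mem_ball_zero_iff.1 hz)

/-- The action on differentials of degree `m`:
`f(z)(dz)^m ↦ f((conj a z - b)/(-conj b z + a)) (-conj b z + a)^(-2m) (dz)^m`. -/
def act (m : ℝ) (g : GTilde) (f : Hol) : Hol :=
  Hol.mk (fun z => extend f.1 (g.mobInv z) * automorphy m g z) (differentiableOn_act m g f)

/-- `ν` is an invariant (Borel) measure on `H^m(Δ)`. -/
def IsInvariant (m : ℝ) (ν : Measure Hol) : Prop :=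
  ∀ g : GTilde, MeasurePreserving (act m g) ν ν

/-! ### The Hilbert space `H^m ∩ L²` -/

lemma extend_contDiffAt (f : Hol) (n : ℕ) : ContDiffAt ℂ n (extend f.1) 0 :=
  (DifferentiableOn.analyticAt f.2 (Metric.ball_mem_nhds 0 one_pos)).contDiffAt

lemma coeff_add (f g : Hol) (n : ℕ) : coeff (f + g) n = coeff f n + coeff g n := by
  have h : extend (f + g).1 = extend f.1 + extend g.1 := extend_add f.1 g.1
  rw [coeff, h, iteratedDeriv_add (extend_contDiffAt f n) (extend_contDiffAt g n), add_div]
  rfl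

lemma coeff_smul (c : ℂ) (f : Hol) (n : ℕ) : coeff (c • f) n = c * coeff f n := by
  have h : extend (c • f).1 = c • extend f.1 := extend_smul c f.1
  rw [coeff, h, iteratedDeriv_const_smul_field, smul_eq_mul, mul_div_assoc]
  rfl

lemma eq_zero_of_coeff (f : Hol) (h : ∀ n, coeff f n = 0) : f = 0 := by
  apply Subtype.ext
  ext z
  have h1 := Complex.taylorSeries_eq_on_ball' z.2 (f := extend f.1) f.2
  rw [extend_coe] at h1
  rw [← h1]
  have h2 : ∀ n, iteratedDeriv n (extend f.1) 0 = 0 := fun n => by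
    have := h n
    rw [coeff, div_eq_zero_iff] at this
    exact this.resolve_right (by exact_mod_cast n.factorial_ne_zero)
  simp only [h2, mul_zero, zero_mul, tsum_zero]
  rfl

lemma coeff_monomial (k n : ℕ) : coeff (monomial k) n = if n = k then 1 else 0 := by
  have h : extend (monomial k).1 =ᶠ[𝓝 0] fun z => z ^ k := by
    filter_upwards [Metric.ball_mem_nhds (0 : ℂ) one_pos] with z hz
    exact extend_coe (monomial k).1 ⟨z, hz⟩
  rw [coeff, h.iteratedDeriv_eq n, iteratedDeriv_fun_pow_zero]
  split_ifs with hnk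
  · subst hnk
    exact div_self (by exact_mod_cast n.factorial_ne_zero)
  · simp

/-- The squared norm `Γ(n+1)Γ(2m)/Γ(2m+n)` of `z^n (dz)^m`. -/
def weight (m : ℝ) (n : ℕ) : ℝ := Real.Gamma (n + 1) * Real.Gamma (2 * m) / Real.Gamma (2 * m + n)

lemma weight_pos {m : ℝ} (hm : 0 < m) (n : ℕ) : 0 < weight m n := by
  have h1 : 0 < Real.Gamma (n + 1) := Real.Gamma_pos_of_pos (by positivity)
  have h2 : 0 < Real.Gamma (2 * m) := Real.Gamma_pos_of_pos (by positivity)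
  have h3 : 0 < Real.Gamma (2 * m + n) := Real.Gamma_pos_of_pos (by positivity)
  unfold weight
  positivity

/-- `H^m ∩ L²`, the differentials with `∑ |f_n|² Γ(n+1)Γ(2m)/Γ(2m+n) < ∞`, as a subspace. -/
def hl2Submodule {m : ℝ} (hm : 0 < m) : Submodule ℂ Hol where
  carrier := {f | Summable fun n => weight m n * ‖coeff f n‖ ^ 2}
  add_mem' {f g} hf hg := by
    refine Summable.of_nonneg_of_le
      (fun n => mul_nonneg (weight_pos hm n).le (sq_nonneg _)) (fun n => ?_)
      ((Summable.add hf hg).mul_left 2)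
    rw [coeff_add]
    have h1 : ‖coeff f n + coeff g n‖ ^ 2 ≤ (‖coeff f n‖ + ‖coeff g n‖) ^ 2 := by
      gcongr
      exact norm_add_le _ _
    have h2 := (weight_pos hm n).le
    nlinarith [mul_nonneg h2 (sq_nonneg (‖coeff f n‖ - ‖coeff g n‖)),
      mul_le_mul_of_nonneg_left h1 h2]
  zero_mem' := by
    have h : ∀ n, coeff 0 n = 0 := fun n => by
      simpa using coeff_smul 0 0 n
    simp [h, summable_zero]
  smul_mem' c f hf := by
    refine (Summable.mul_left (‖c‖ ^ 2) hf).congr fun n => ?_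
    rw [coeff_smul, norm_mul]
    ring

/-- The Hilbert space `H^m ∩ L²`, `m > 0`. -/
def HL2 {m : ℝ} (hm : 0 < m) : Type := hl2Submodule hm

namespace HL2

variable {m : ℝ} {hm : 0 < m}

instance : AddCommGroup (HL2 hm) := Submodule.addCommGroup (hl2Submodule hm)

instance : Module ℂ (HL2 hm) := Submodule.module (hl2Submodule hm)

/-- The inclusion of `H^m ∩ L²` in `H^m`. -/
def incl : HL2 hm →ₗ[ℂ] Hol := (hl2Submodule hm).subtype

lemma summable_sq (f : HL2 hm) : Summable fun n => weight m n * ‖coeff f.incl n‖ ^ 2 := f.2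

lemma summable_inner (f g : HL2 hm) :
    Summable fun n => (weight m n : ℂ) * (conj (coeff f.incl n) * coeff g.incl n) := by
  refine Summable.of_norm_bounded ((f.summable_sq).add g.summable_sq) fun n => ?_
  have h := (weight_pos hm n).le
  rw [norm_mul, norm_mul, RCLike.norm_conj, Complex.norm_real, Real.norm_of_nonneg h]
  nlinarith [mul_nonneg h (sq_nonneg (‖coeff f.incl n‖ - ‖coeff g.incl n‖)),
    mul_nonneg h (sq_nonneg ‖coeff f.incl n‖), mul_nonneg h (sq_nonneg ‖coeff g.incl n‖)]

/-- The inner product `⟨f, g⟩ = ∑ conj(f_n) g_n Γ(n+1)Γ(2m)/Γ(2m+n)`, linear in `g`. For `m > 1/2`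
it is the inner product of `L²` of the disc for the measure
`(2m-1)/π (1-|z|²)^(2m-2) dx dy`. -/
@[reducible]
def innerCore : InnerProductSpace.Core ℂ (HL2 hm) where
  inner f g := ∑' n, (weight m n : ℂ) * (conj (coeff f.incl n) * coeff g.incl n)
  conj_inner_symm f g := by
    rw [Complex.conj_tsum]
    refine tsum_congr fun n => ?_
    simp only [map_mul, Complex.conj_conj, Complex.conj_ofReal]
    ring
  re_inner_nonneg f := by
    have h : ∀ n, (weight m n : ℂ) * (conj (coeff f.incl n) * coeff f.incl n)
        = ((weight m n * ‖coeff f.incl n‖ ^ 2 : ℝ) : ℂ) := fun n => by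
      rw [Complex.conj_mul']
      push_cast
      ring
    simp_rw [h]
    rw [← Complex.ofReal_tsum]
    exact tsum_nonneg fun n => mul_nonneg (weight_pos hm n).le (sq_nonneg _)
  add_left f g k := by
    rw [← (summable_inner f k).tsum_add (summable_inner g k)]
    refine tsum_congr fun n => ?_
    rw [map_add, coeff_add, map_add]
    ring
  smul_left f g c := by
    rw [← tsum_mul_left]
    refine tsum_congr fun n => ?_
    rw [map_smul, coeff_smul, map_mul]
    ring
  definite f hf := by
    have h : ∀ n, (weight m n : ℂ) * (conj (coeff f.incl n) * coeff f.incl n)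
        = ((weight m n * ‖coeff f.incl n‖ ^ 2 : ℝ) : ℂ) := fun n => by
      rw [Complex.conj_mul']
      push_cast
      ring
    change ∑' n, (weight m n : ℂ) * (conj (coeff f.incl n) * coeff f.incl n) = 0 at hf
    simp_rw [h] at hf
    rw [← Complex.ofReal_tsum, Complex.ofReal_eq_zero] at hf
    have h0 := (f.summable_sq.hasSum_iff.2 hf)
    rw [hasSum_zero_iff_of_nonneg fun n => mul_nonneg (weight_pos hm n).le (sq_nonneg _)] at h0
    have h1 : f.incl = 0 := eq_zero_of_coeff _ fun n => by
      have := congrFun h0 n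
      simpa [(weight_pos hm n).ne'] using this
    exact Subtype.ext h1

instance : NormedAddCommGroup (HL2 hm) := (innerCore (hm := hm)).toNormedAddCommGroup

instance : InnerProductSpace ℂ (HL2 hm) := InnerProductSpace.ofCore (innerCore (hm := hm)).toCore

/-- The monomial `z^n (dz)^m` as an element of `H^m ∩ L²`. -/
def monomial (hm : 0 < m) (n : ℕ) : HL2 hm :=
  ⟨HolDiff.monomial n, by
    refine summable_of_ne_finset_zero (s := {n}) fun k hk => ?_
    rw [coeff_monomial, if_neg (by simpa using hk)]
    simp⟩

end HL2

/-! ### The distribution of a functional on `H^m ∩ L²` under a measure on `H^m` -/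

/-- The value of `φ` on the Taylor polynomial of degree `< N` of `f`. -/
def partialEval {m : ℝ} {hm : 0 < m} (φ : StrongDual ℂ (HL2 hm)) (N : ℕ) (f : Hol) : ℂ :=
  φ (∑ n ∈ Finset.range N, coeff f n • HL2.monomial hm n)

/-- A functional `φ` on `H^m ∩ L²` is regarded as a random variable on the larger space `H^m` with
the probability measure `ν`: `X` is (a version of) `φ` under `ν` if it is the limit in
`ν`-probability of the values of `φ` on the Taylor polynomials. Such an `X` is `ν`-almost everywhere
unique, and `φ_*ν` is the law `ν.map X` of `X`. If `φ` extends to a continuous functional on `H^m`,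
then `X = φ`. -/
def IsVersion {m : ℝ} {hm : 0 < m} (ν : Measure Hol) (φ : StrongDual ℂ (HL2 hm))
    (X : Hol → ℂ) : Prop :=
  AEMeasurable X ν ∧ TendstoInMeasure ν (partialEval φ) atTop X

/-- The variance of a complex random variable, normalized as the mean of the variances of the
real and the imaginary part (half of `E|X - E X|²`), so that the Gaussian with density
`(2πσ²)⁻¹ exp(-|z|²/(2σ²))` on `ℂ` has variance `σ²`. -/
def complexVariance (X : Hol → ℂ) (ν : Measure Hol) : ℝ :=
  (Var[fun f => (X f).re; ν] + Var[fun f => (X f).im; ν]) / 2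

/-! ### Gaussian measures and scaled convolutions -/

/-- The Gaussian `(2πv)⁻¹ exp(-|z|²/(2v)) dm(z)` on `ℂ` (the unit mass at `0` if `v = 0`). -/
def complexGaussian (v : ℝ≥0) : Measure ℂ :=
  ((gaussianReal 0 v).prod (gaussianReal 0 v)).map fun p => (p.1 : ℂ) + p.2 * Complex.I

/-- The Gaussian measure `ν_T^{(m)}` on `H^m`: the infinite product over `n` of the Gaussians
`w_n/(2πT) exp(-w_n |f_n|²/(2T)) dm(f_n)`, `w_n = Γ(n+1)Γ(2m)/Γ(2m+n)`, in the Taylor coefficients,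
restricted to the sequences `(f_n)` of Taylor coefficients of elements of `H^m`. -/
def gaussian (m : ℝ) (T : ℝ≥0) : Measure Hol :=
  (Measure.infinitePi fun n : ℕ => complexGaussian (T / (weight m n).toNNReal)).comap coeff

/-- The `n`-fold convolution `ν * ⋯ * ν`. -/
def convPow (ν : Measure Hol) : ℕ → Measure Hol
  | 0 => Measure.dirac 0
  | n + 1 => (convPow ν n).conv ν

/-- The scaled `n`-fold convolution `E ↦ ν^{*n}(√n E)`. -/
def scaledConv (ν : Measure Hol) (n : ℕ) : Measure Hol :=
  (convPow ν n).map fun f => ((Real.sqrt n)⁻¹ : ℂ) • f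

instance (ν : Measure Hol) [IsProbabilityMeasure ν] (n : ℕ) :
    IsProbabilityMeasure (convPow ν n) := by
  induction n with
  | zero => exact inferInstanceAs (IsProbabilityMeasure (Measure.dirac 0))
  | succ n ih => exact inferInstanceAs (IsProbabilityMeasure ((convPow ν n).conv ν))

instance (ν : Measure Hol) [IsProbabilityMeasure ν] (n : ℕ) :
    IsProbabilityMeasure (scaledConv ν n) :=
  Measure.isProbabilityMeasure_map (continuous_const_smul _).measurable.aemeasurable

end HolDiff

end

noncomputable section

namespace HolDiff

/-! ### Power series on the unit disc -/

/-! Invariance determines the covariance of the Taylor coefficients up to one constant, and the rest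
is a central limit theorem. Rotations multiply `f_n` by a character of weight proportional to `m +
n`. Since `m > 0`, this makes `E f_n` and all `E f_n f_k` vanish, and also `E f_n conj f_k` for `n ≠
k`. A boost carrying `0` to `z` gives `E |f(z)|² = (1 - |z|²)^(-2m) E |f_0|²`. Averaging over the
circle `|z| = r` turns this into `∑ r^(2n) E |f_n|² = (1 - r²)^(-2m) E |f_0|²`, and the binomial
series has coefficients `1 / w_n`, so `E |f_n|² = E |f_0|² / w_n` (`integral_norm_sq_coeff`). With
`2T = E |f_0|²` these are exactly the second moments of `gaussian m T`, a fact recorded as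
`HasGaussianCov`.

Dually, `‖φ‖² = ∑ |φ(z^n)|² / w_n` (`hasSum_norm_sq_dual`), so the partial evaluations of `φ` are
Cauchy in `L²` at a rate depending only on `φ` and `T`. Hence `φ` has a version, with variance `T
‖φ‖²`.

Scaled convolution does not increase these second moments. Finitely many coefficients converge in
law by the one-dimensional central limit theorem and characteristic functions
(`tendstoInDistribution_coeffs`). Markov's inequality makes the error of Taylor truncation small
uniformly in `n`, on every disc of radius `r < 1` and likewise for each `φ`. The uniform
approximation lemma `tendstoInDistribution_of_approx` then gives both weak limits, with no separate
tightness argument. -/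

lemma eq_zero_of_hasSum_zero (d : ℕ → ℂ)
    (h : ∀ x : ℝ, 0 < x → x < 1 → HasSum (fun n => d n * (x : ℂ) ^ n) 0) : d = 0 := by
  set p := FormalMultilinearSeries.ofScalars ℂ d with hp
  have hr : ((1 / 2 : ℝ≥0) : ENNReal) ≤ p.radius := by
    refine p.le_radius_of_tendsto (l := 0) ?_
    have h1 := (h (1 / 2) (by norm_num) (by norm_num)).summable.norm.tendsto_atTop_zero
    refine h1.congr fun n => ?_
    rw [hp, FormalMultilinearSeries.ofScalars_norm]
    simp
  have hpos : 0 < p.radius := lt_of_lt_of_le (by simp) hr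
  have hps := p.hasFPowerSeriesOnBall hpos
  -- The positive reals accumulate at `0`, so the identity theorem applies even though vanishing is
  -- known only on `(0, 1)`.
  have hfreq : ∃ᶠ z in 𝓝[≠] (0 : ℂ), p.sum z = 0 := by
    have ht : Tendsto (fun x : ℝ => (x : ℂ)) (𝓝[>] 0) (𝓝[≠] 0) := by
      refine tendsto_nhdsWithin_iff.2 ⟨?_, ?_⟩
      · exact (Complex.continuous_ofReal.tendsto' 0 0 (by simp)).mono_left nhdsWithin_le_nhds
      · filter_upwards [self_mem_nhdsWithin] with x hx
        simpa using (ne_of_gt hx : x ≠ 0)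
    refine ht.frequently (Eventually.frequently ?_)
    filter_upwards [Ioo_mem_nhdsGT (zero_lt_one' ℝ)] with x hx
    have h1 := (h x hx.1 hx.2).tsum_eq
    rw [← h1]
    exact tsum_congr fun n => by
      rw [hp]; simp [mul_comm]
  have hev := (hps.analyticAt.frequently_zero_iff_eventually_zero).1 hfreq
  have h0 : p = 0 := (hps.hasFPowerSeriesAt.congr hev).eq_zero
  exact (FormalMultilinearSeries.ofScalars_series_eq_zero ℂ (c := d)).1 (hp ▸ h0)

lemma hasSum_coeff (f : Hol) {z : ℂ} (hz : ‖z‖ < 1) :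
    HasSum (fun n => coeff f n * z ^ n) (extend f.1 z) := by
  have h := Complex.hasSum_taylorSeries_on_ball (f := extend f.1) f.2 (mem_ball_zero_iff.2 hz)
  refine h.congr_fun fun n => ?_
  rw [coeff, sub_zero, smul_eq_mul, smul_eq_mul]
  ring

lemma summable_norm_coeff (f : Hol) {r : ℝ} (h0 : 0 ≤ r) (hr : r < 1) :
    Summable fun n => ‖coeff f n‖ * r ^ n := by
  have h := (hasSum_coeff f (z := r) (by simpa [abs_of_nonneg h0])).summable.norm
  refine h.congr fun n => ?_
  simp [abs_of_nonneg h0]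

lemma coeff_eq_of_hasSum (f : Hol) (b : ℕ → ℂ)
    (h : ∀ z : ℂ, ‖z‖ < 1 → HasSum (fun n => b n * z ^ n) (extend f.1 z)) : coeff f = b := by
  rw [← sub_eq_zero]
  refine eq_zero_of_hasSum_zero _ fun x hx0 hx1 => ?_
  have hx : ‖(x : ℂ)‖ < 1 := by simpa [abs_of_pos hx0]
  have h1 := (hasSum_coeff f hx).sub (h x hx)
  rw [sub_self] at h1
  exact h1.congr_fun fun n => by simp [sub_mul]

lemma coeff_injective : Function.Injective coeff := by
  intro f g h
  apply Subtype.ext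
  ext z
  have hz : ‖(z : ℂ)‖ < 1 := mem_ball_zero_iff.1 z.2
  rw [← extend_coe, ← extend_coe]
  have h1 := hasSum_coeff f hz
  rw [h] at h1
  exact h1.unique (hasSum_coeff g hz)

lemma extend_mk (F : ℂ → ℂ) (hF : DifferentiableOn ℂ F (Metric.ball 0 1)) {z : ℂ} (hz : ‖z‖ < 1) :
    extend (Hol.mk F hF).1 z = F z :=
  extend_coe (Hol.mk F hF).1 ⟨z, mem_ball_zero_iff.2 hz⟩

/-- This identifies enough random sequences as Taylor sequences to place the product Gaussian on
`Hol`. -/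
lemma mem_range_coeff (x : ℕ → ℂ)
    (hx : ∀ r : ℝ, 0 < r → r < 1 → Summable fun n => ‖x n‖ * r ^ n) : x ∈ Set.range coeff := by
  have hd : DifferentiableOn ℂ (fun z => ∑' n, x n * z ^ n) (Metric.ball 0 1) := by
    intro z hz
    rw [mem_ball_zero_iff] at hz
    obtain ⟨r, hzr, hr⟩ := exists_between hz
    have h1 : DifferentiableOn ℂ (fun z => ∑' n, x n * z ^ n) (Metric.ball 0 r) := by
      refine Complex.differentiableOn_tsum_of_summable_norm (hx r ((norm_nonneg z).trans_lt hzr) hr)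
        (fun n => by fun_prop) Metric.isOpen_ball fun n w hw => ?_
      rw [mem_ball_zero_iff] at hw
      rw [norm_mul, norm_pow]
      gcongr
    exact (h1.differentiableAt (Metric.isOpen_ball.mem_nhds
      (mem_ball_zero_iff.2 hzr))).differentiableWithinAt
  refine ⟨Hol.mk _ hd, coeff_eq_of_hasSum _ _ fun z hz => ?_⟩
  rw [extend_mk _ _ hz]
  refine Summable.hasSum ?_
  obtain ⟨r, hzr, hr⟩ := exists_between hz
  refine Summable.of_norm_bounded (hx r ((norm_nonneg z).trans_lt hzr) hr) fun n => ?_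
  rw [norm_mul, norm_pow]
  gcongr

/-! ### Topology and Borel structure of the space of holomorphic differentials -/

lemma continuous_val : Continuous (fun f : Hol => (f.1 : C(Disc, ℂ))) := continuous_subtype_val

lemma tendstoUniformlyOn_extend (f : Hol) {r : ℝ} (hr : r < 1) :
    TendstoUniformlyOn (fun g : Hol => extend g.1) (extend f.1) (𝓝 f)
      (Metric.closedBall 0 r) := by
  set K : Set Disc := (↑) ⁻¹' Metric.closedBall (0 : ℂ) r
  have hK : IsCompact K := by
    rw [Topology.IsEmbedding.subtypeVal.isCompact_iff, Subtype.image_preimage_coe,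
      Set.inter_eq_right.2 (Metric.closedBall_subset_ball hr)]
    exact isCompact_closedBall 0 r
  have h := (ContinuousMap.tendsto_iff_forall_isCompact_tendstoUniformlyOn.1
    (continuous_val.tendsto f)) K hK
  rw [Metric.tendstoUniformlyOn_iff] at h ⊢
  intro ε hε
  filter_upwards [h ε hε] with g hg z hz
  have h1 := hg ⟨z, Metric.closedBall_subset_ball hr hz⟩ hz
  rwa [← extend_coe, ← extend_coe] at h1

/-- Cauchy's estimate on the circle of radius `1/2`; it makes each coefficient continuous. -/
lemma norm_coeff_le (f : Hol) (n : ℕ) {C : ℝ}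
    (hC : ∀ z ∈ Metric.closedBall (0 : ℂ) (1 / 2), ‖extend f.1 z‖ ≤ C) :
    ‖coeff f n‖ ≤ C / (1 / 2) ^ n := by
  have h := Complex.norm_iteratedDeriv_le_of_forall_mem_sphere_norm_le (f := extend f.1) (c := 0)
    (R := 1 / 2) (C := C) n (by norm_num) ?_ fun z hz => hC z (Metric.sphere_subset_closedBall hz)
  · rw [coeff, norm_div, Complex.norm_natCast, div_le_iff₀ (by positivity)]
    calc _ ≤ _ := h
      _ = _ := by ring
  · refine DifferentiableOn.diffContOnCl (f.2.mono ?_)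
    exact (Metric.closure_ball_subset_closedBall).trans
      (Metric.closedBall_subset_ball (by norm_num))

lemma coeff_sub (f g : Hol) (n : ℕ) : coeff (f - g) n = coeff f n - coeff g n := by
  have h := coeff_add (f - g) g n
  rw [sub_add_cancel] at h
  rw [h, add_sub_cancel_right]

lemma extend_sub (f g : Hol) (z : ℂ) : extend (f - g).1 z = extend f.1 z - extend g.1 z := by
  have h := congrFun (extend_add (f - g).1 g.1) z
  have h2 : (f - g).1 + g.1 = f.1 := congrArg Subtype.val (sub_add_cancel f g)
  rw [h2, Pi.add_apply] at h
  rw [h, add_sub_cancel_right]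

lemma continuous_coeff_apply (n : ℕ) : Continuous fun f => coeff f n := by
  rw [continuous_iff_continuousAt]
  intro f
  rw [ContinuousAt, Metric.tendsto_nhds]
  intro ε hε
  have h := tendstoUniformlyOn_extend f (r := 1 / 2) (by norm_num)
  rw [Metric.tendstoUniformlyOn_iff] at h
  filter_upwards [h (ε / 2 * (1 / 2) ^ n) (by positivity)] with g hg
  rw [dist_eq_norm, ← coeff_sub]
  refine (norm_coeff_le (g - f) n (C := ε / 2 * (1 / 2) ^ n) fun z hz => ?_).trans_lt ?_
  · rw [extend_sub, ← dist_eq_norm, dist_comm]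
    exact (hg z hz).le
  · rw [mul_div_assoc, div_self (by positivity), mul_one]
    linarith

lemma continuous_coeff : Continuous coeff := continuous_pi continuous_coeff_apply

@[fun_prop]
lemma measurable_coeff_apply (n : ℕ) : Measurable fun f => coeff f n :=
  (continuous_coeff_apply n).measurable

/-- Weierstrass: locally uniform limits of holomorphic functions are holomorphic. Closedness makes
`Hol` Polish. -/
lemma isClosed_holSubmodule : IsClosed (holSubmodule : Set C(Disc, ℂ)) := by
  rw [isClosed_iff_clusterPt]
  intro f hf
  have : (𝓝 f ⊓ 𝓟 (holSubmodule : Set C(Disc, ℂ))).NeBot := hf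
  have h : TendstoLocallyUniformlyOn (fun g : C(Disc, ℂ) => extend g) (extend f)
      (𝓝 f ⊓ 𝓟 (holSubmodule : Set C(Disc, ℂ))) (Metric.ball 0 1) := by
    rw [tendstoLocallyUniformlyOn_iff_forall_isCompact Metric.isOpen_ball]
    intro K hK1 hK
    set K' : Set Disc := (↑) ⁻¹' K
    have hK' : IsCompact K' := by
      rw [Topology.IsEmbedding.subtypeVal.isCompact_iff, Subtype.image_preimage_coe,
        Set.inter_eq_right.2 hK1]
      exact hK
    have h := (ContinuousMap.tendsto_iff_forall_isCompact_tendstoUniformlyOn.1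
      (tendsto_id'.2 (inf_le_left : 𝓝 f ⊓ 𝓟 (holSubmodule : Set C(Disc, ℂ)) ≤ 𝓝 f))) K' hK'
    rw [Metric.tendstoUniformlyOn_iff] at h ⊢
    intro ε hε
    filter_upwards [h ε hε] with g hg z hz
    have h1 := hg ⟨z, hK1 hz⟩ hz
    rwa [← extend_coe, ← extend_coe] at h1
  refine h.differentiableOn ?_ Metric.isOpen_ball
  exact eventually_inf_principal.2 (Eventually.of_forall fun g hg => hg)

instance : PolishSpace C(Disc, ℂ) :=
  letI := UniformSpace.metricSpace C(Disc, ℂ)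
  inferInstance

instance : PolishSpace Hol := isClosed_holSubmodule.polishSpace

/-- Lusin–Souslin: a continuous injection of a Polish space has Borel images of Borel sets. This is
what makes the `comap` in `gaussian` meaningful. -/
lemma measurableEmbedding_coeff : MeasurableEmbedding coeff :=
  continuous_coeff.measurableEmbedding coeff_injective

/-! ### The weights -/

/-- The binomial series: its `n`-th coefficient is the rising factorial of `2m` over `n!`, and that
rising factorial equals `Γ(2m+n)/Γ(2m)`. -/
lemma hasSum_inv_weight {m : ℝ} (hm : 0 < m) {x : ℝ} (hx0 : 0 ≤ x) (hx : x < 1) :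
    HasSum (fun n => (weight m n)⁻¹ * x ^ n) ((1 - x) ^ (-(2 * m))) := by
  have h := (Real.one_div_one_sub_rpow_hasFPowerSeriesOnBall_zero (2 * m)).hasSum (y := x)
    (by simpa [enorm_eq_nnnorm, ← NNReal.coe_lt_coe, abs_of_nonneg hx0] using! hx)
  rw [zero_add, one_div, ← Real.rpow_neg (by linarith)] at h
  refine h.congr_fun fun n => ?_
  have h1 : Ring.choose (2 * m + n - 1) n = (weight m n)⁻¹ := by
    rw [← Ring.multichoose_eq]
    have h2 := Ring.factorial_nsmul_multichoose_eq_ascPochhammer (2 * m) n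
    rw [Polynomial.ascPochhammer_smeval_eq_eval] at h2
    have h3 : (ascPochhammer ℝ n).eval (2 * m) = Real.Gamma (2 * m + n) / Real.Gamma (2 * m) := by
      clear h2 h
      induction n with
      | zero => simp [(Real.Gamma_pos_of_pos (by positivity : 0 < 2 * m)).ne']
      | succ n ih =>
        rw [ascPochhammer_succ_eval, ih, Nat.cast_succ, ← add_assoc,
          Real.Gamma_add_one (by positivity)]
        ring
    rw [h3, nsmul_eq_mul] at h2
    rw [weight, Real.Gamma_nat_eq_factorial, inv_div, ← div_div, div_right_comm, ← h2]
    field_simp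
  rw [FormalMultilinearSeries.ofScalars_apply_eq, h1, smul_eq_mul]

/-- Square roots appear because first moments of coefficients are bounded through second moments.
The bound `√y ≤ 1 + y` reduces the claim to the geometric and binomial series. -/
lemma summable_sqrt_inv_weight {m : ℝ} (hm : 0 < m) {x : ℝ} (hx0 : 0 ≤ x) (hx : x < 1) :
    Summable fun n => √(weight m n)⁻¹ * x ^ n := by
  refine Summable.of_nonneg_of_le (fun n => by positivity) (fun n => ?_)
    ((summable_geometric_of_lt_one hx0 hx).add (hasSum_inv_weight hm hx0 hx).summable)
  have h : √(weight m n)⁻¹ ≤ 1 + (weight m n)⁻¹ := by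
    have h0 := (inv_pos.2 (weight_pos hm n)).le
    nlinarith [Real.sq_sqrt h0, sq_nonneg (√(weight m n)⁻¹ - 1), Real.sqrt_nonneg (weight m n)⁻¹]
  have := mul_le_mul_of_nonneg_right h (pow_nonneg hx0 n)
  linarith

/-! ### Parseval's identity on circles -/

lemma integral_exp_int_mul (k : ℤ) :
    ∫ θ in (0 : ℝ)..2 * Real.pi, Complex.exp (k * (θ * Complex.I)) =
      if k = 0 then 2 * Real.pi else 0 := by
  split_ifs with hk
  · simp [hk]
  · have hc : (k : ℂ) * Complex.I ≠ 0 := by simp [hk]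
    have h := integral_exp_mul_complex (a := 0) (b := 2 * Real.pi) hc
    have h2 : ∀ θ : ℝ, (k : ℂ) * (θ * Complex.I) = k * Complex.I * θ := fun θ => by ring
    simp_rw [h2, h]
    have h3 : (k : ℂ) * Complex.I * ((2 * Real.pi : ℝ) : ℂ) = k * (2 * Real.pi * Complex.I) := by
      push_cast; ring
    rw [h3, Complex.exp_int_mul_two_pi_mul_I]
    simp

lemma hasSum_integral_circle {u : ℕ → ℂ} (hu : Summable fun n => ‖u n‖) {F : ℝ → ℂ}
    (hF : ∀ θ : ℝ, HasSum (fun n => u n * Complex.exp (n * (θ * Complex.I))) (F θ))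
    {G : ℝ → ℂ} (hG : Continuous G) {C : ℝ} (hGC : ∀ θ, ‖G θ‖ ≤ C) :
    HasSum (fun n : ℕ => u n * ∫ θ in (0 : ℝ)..2 * Real.pi,
      Complex.exp (n * (θ * Complex.I)) * G θ) (∫ θ in (0 : ℝ)..2 * Real.pi, F θ * G θ) := by
  have h := intervalIntegral.hasSum_integral_of_dominated_convergence (a := 0) (b := 2 * Real.pi)
    (μ := volume) (F := fun n (θ : ℝ) => u n * Complex.exp (n * (θ * Complex.I)) * G θ)
    (f := fun θ => F θ * G θ) (fun n _ => ‖u n‖ * C) (fun n => ?_) (fun n => ?_) ?_ ?_ ?_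
  · refine h.congr_fun fun n => ?_
    rw [← intervalIntegral.integral_const_mul]
    exact intervalIntegral.integral_congr fun θ _ => by ring
  · exact (by fun_prop : Continuous fun θ : ℝ =>
      u n * Complex.exp (n * (θ * Complex.I)) * G θ).aestronglyMeasurable
  · refine Eventually.of_forall fun θ _ => ?_
    have h1 : ‖Complex.exp (n * (θ * Complex.I))‖ = 1 := by
      have : (n : ℂ) * (θ * Complex.I) = ((n * θ : ℝ) : ℂ) * Complex.I := by push_cast; ring
      rw [this, Complex.norm_exp_ofReal_mul_I]
    rw [norm_mul, norm_mul, h1, mul_one]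
    exact mul_le_mul_of_nonneg_left (hGC θ) (norm_nonneg _)
  · exact Eventually.of_forall fun θ _ => hu.mul_right C
  · exact continuous_const.intervalIntegrable _ _
  · exact Eventually.of_forall fun θ _ => (hF θ).mul_right _

lemma hasSum_parseval {u : ℕ → ℂ} (hu : Summable fun n => ‖u n‖) {F : ℝ → ℂ} (hc : Continuous F)
    (hF : ∀ θ : ℝ, HasSum (fun n => u n * Complex.exp (n * (θ * Complex.I))) (F θ)) :
    HasSum (fun n => 2 * Real.pi * ‖u n‖ ^ 2) (∫ θ in (0 : ℝ)..2 * Real.pi, ‖F θ‖ ^ 2) := by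
  have hexp : ∀ (n : ℕ) (θ : ℝ), ‖Complex.exp (n * (θ * Complex.I))‖ = 1 := fun n θ => by
    have : (n : ℂ) * (θ * Complex.I) = ((n * θ : ℝ) : ℂ) * Complex.I := by push_cast; ring
    rw [this, Complex.norm_exp_ofReal_mul_I]
  have hFC : ∀ θ, ‖F θ‖ ≤ ∑' n, ‖u n‖ := fun θ => by
    rw [← (hF θ).tsum_eq]
    refine (norm_tsum_le_tsum_norm ?_).trans (le_of_eq (tsum_congr fun n => ?_))
    · simpa [hexp] using hu
    · rw [norm_mul, hexp, mul_one]
  have h1 := hasSum_integral_circle hu hF (G := fun θ => conj (F θ)) (by fun_prop)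
    (C := ∑' n, ‖u n‖) (fun θ => by simpa using hFC θ)
  have h2 : ∀ n : ℕ, ∫ θ in (0 : ℝ)..2 * Real.pi,
      Complex.exp (n * (θ * Complex.I)) * conj (F θ) = 2 * Real.pi * conj (u n) := fun n => by
    -- Termwise integration is used a second time, against `exp(-inθ)`, to recover `u n` as a
    -- Fourier coefficient of `F`.
    have h3 := hasSum_integral_circle hu hF
      (G := fun θ => Complex.exp (-(n * (θ * Complex.I)))) (by fun_prop) (C := 1) (fun θ => by
        rw [Complex.exp_neg, norm_inv, hexp, inv_one])
    have h4 : ∀ k : ℕ, ∫ θ in (0 : ℝ)..2 * Real.pi, Complex.exp (k * (θ * Complex.I)) *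
        Complex.exp (-(n * (θ * Complex.I))) = if k = n then 2 * Real.pi else 0 := fun k => by
      have h5 := integral_exp_int_mul (k - n)
      simp only [sub_eq_zero, Nat.cast_inj, Int.cast_sub, Int.cast_natCast] at h5
      rw [← h5]
      refine intervalIntegral.integral_congr fun θ _ => ?_
      rw [← Complex.exp_add]
      congr 1
      ring
    simp_rw [h4] at h3
    have h6 := h3.unique (hasSum_single n fun k hk => by simp [hk])
    rw [if_pos rfl] at h6
    have h7 := congrArg conj h6
    rw [← intervalIntegral.intervalIntegral_conj, map_mul, Complex.conj_ofReal] at h7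
    push_cast at h7
    rw [mul_comm (2 * (Real.pi : ℂ)), ← h7]
    refine intervalIntegral.integral_congr fun θ _ => ?_
    simp only [← Complex.exp_conj, map_neg, map_mul, Complex.conj_natCast, Complex.conj_ofReal,
      Complex.conj_I]
    rw [mul_comm]
    congr 2
    ring
  simp_rw [h2] at h1
  have h8 : ∀ n, u n * (2 * Real.pi * conj (u n)) = ((2 * Real.pi * ‖u n‖ ^ 2 : ℝ) : ℂ) :=
    fun n => by
      have := Complex.mul_conj' (u n)
      push_cast
      rw [← this]
      ring
  have h9 : ∫ θ in (0 : ℝ)..2 * Real.pi, F θ * conj (F θ) =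
      ((∫ θ in (0 : ℝ)..2 * Real.pi, ‖F θ‖ ^ 2 : ℝ) : ℂ) := by
    rw [← intervalIntegral.integral_ofReal]
    exact intervalIntegral.integral_congr fun θ _ => by simp [Complex.mul_conj']
  simp_rw [h8] at h1
  rw [h9] at h1
  exact_mod_cast h1

/-! ### Rotations and boosts of the disc -/

/-- The lift to `GTilde` of the rotation `z ↦ exp(2iθ) z` of the disc. -/
def GTilde.rotation (θ : ℝ) : GTilde where
  a := Complex.exp (θ * Complex.I)
  b := 0
  A := θ * Complex.I
  det_eq := by simp [Complex.norm_exp_ofReal_mul_I]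
  exp_eq := rfl

lemma act_apply (m : ℝ) (g : GTilde) (f : Hol) {z : ℂ} (hz : ‖z‖ < 1) :
    extend (act m g f).1 z = extend f.1 (g.mobInv z) * automorphy m g z :=
  extend_mk _ _ hz

lemma coeff_act_rotation (m θ : ℝ) (f : Hol) (n : ℕ) :
    coeff (act m (GTilde.rotation θ) f) n =
      Complex.exp (((-2 * (m + n) * θ : ℝ) : ℂ) * Complex.I) * coeff f n := by
  refine congrFun (coeff_eq_of_hasSum _
    (fun n => Complex.exp (((-2 * (m + n) * θ : ℝ) : ℂ) * Complex.I) * coeff f n)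
    fun z hz => ?_) n
  have hmob : (GTilde.rotation θ).mobInv z = Complex.exp (-2 * θ * Complex.I) * z := by
    simp only [GTilde.mobInv, GTilde.rotation, ← Complex.exp_conj, map_zero, neg_zero, zero_mul,
      zero_add, sub_zero, map_mul, Complex.conj_ofReal, Complex.conj_I]
    rw [div_eq_iff (Complex.exp_ne_zero _), mul_right_comm, ← Complex.exp_add]
    congr 2
    ring
  have hnorm : ‖Complex.exp (-2 * θ * Complex.I) * z‖ < 1 := by
    have : (-2 * θ * Complex.I : ℂ) = ((-2 * θ : ℝ) : ℂ) * Complex.I := by push_cast; ring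
    rw [norm_mul, this, Complex.norm_exp_ofReal_mul_I, one_mul]
    exact hz
  have haut : automorphy m (GTilde.rotation θ) z = Complex.exp (-2 * m * (θ * Complex.I)) := by
    simp [automorphy, GTilde.rotation]
  rw [act_apply m _ f hz, hmob, haut]
  refine ((hasSum_coeff f hnorm).mul_right _).congr_fun fun k => ?_
  have hexp : Complex.exp (((-2 * (m + k) * θ : ℝ) : ℂ) * Complex.I) =
      Complex.exp (k * (-2 * θ * Complex.I)) * Complex.exp (-2 * m * (θ * Complex.I)) := by
    rw [← Complex.exp_add]
    congr 1
    push_cast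
    ring
  rw [mul_pow, ← Complex.exp_nat_mul, hexp]
  ring

/-- A boost in `GTilde` whose inverse moves `0` to `z`. -/
def GTilde.boost (z : ℂ) (hz : ‖z‖ < 1) : GTilde where
  a := ((√(1 - ‖z‖ ^ 2))⁻¹ : ℝ)
  b := -z * ((√(1 - ‖z‖ ^ 2))⁻¹ : ℝ)
  A := (Real.log (√(1 - ‖z‖ ^ 2))⁻¹ : ℝ)
  det_eq := by
    have h : 0 < 1 - ‖z‖ ^ 2 := by nlinarith [norm_nonneg z]
    rw [norm_mul, norm_neg, Complex.norm_real, mul_pow, Real.norm_eq_abs, sq_abs, inv_pow,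
      Real.sq_sqrt h.le]
    field_simp
  exp_eq := by
    have h : 0 < 1 - ‖z‖ ^ 2 := by nlinarith [norm_nonneg z]
    rw [← Complex.ofReal_exp, Real.exp_log (by positivity)]

/-- At the origin the automorphy factor is `a^(-2m) = (1 - |z|²)^m`, because the boost has `a` real
and `A = log a`. -/
lemma norm_act_boost_zero (m : ℝ) (f : Hol) {z : ℂ} (hz : ‖z‖ < 1) :
    ‖coeff (act m (GTilde.boost z hz) f) 0‖ ^ 2 =
      (1 - ‖z‖ ^ 2) ^ (2 * m) * ‖extend f.1 z‖ ^ 2 := by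
  have h : 0 < 1 - ‖z‖ ^ 2 := by nlinarith [norm_nonneg z]
  have h0 : ∀ F : Hol, coeff F 0 = extend F.1 0 := fun F => by simp [coeff]
  have hmob : (GTilde.boost z hz).mobInv 0 = z := by
    have : (√(1 - ‖z‖ ^ 2) : ℂ) ≠ 0 := by
      exact_mod_cast (Real.sqrt_pos.2 h).ne'
    simp [GTilde.mobInv, GTilde.boost, this]
  have haut : automorphy m (GTilde.boost z hz) 0 = ((1 - ‖z‖ ^ 2) ^ m : ℝ) := by
    have hs := Real.log_sqrt h.le
    rw [Real.rpow_def_of_pos h]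
    simp only [automorphy, GTilde.boost, mul_zero, sub_zero, Complex.one_cpow, mul_one,
      Real.log_inv, hs, Complex.ofReal_exp]
    congr 1
    push_cast
    ring
  rw [h0, act_apply m _ f (by simp), hmob, haut, norm_mul, mul_pow, mul_comm, Complex.norm_real,
    Real.norm_of_nonneg (by positivity), ← Real.rpow_natCast, ← Real.rpow_mul h.le]
  norm_num [mul_comm]

/-! ### Second moments of an invariant measure -/

section Invariant

variable {m : ℝ} {ν : Measure Hol}

/-- The angle `π / (2s)` makes the character equal to `-1`, so the integral equals its own negative.
Integrability is not needed: the identities used also hold with the default value `0` of the Bochner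
integral. -/
lemma integral_eq_zero_of_rotation (hinv : IsInvariant m ν) {s : ℝ} (hs : s ≠ 0)
    {F : Hol → ℂ} (hF : Measurable F)
    (h : ∀ θ f, F (act m (GTilde.rotation θ) f) =
      Complex.exp (((-2 * s * θ : ℝ) : ℂ) * Complex.I) * F f) :
    ∫ f, F f ∂ν = 0 := by
  have hp := hinv (GTilde.rotation (Real.pi / (2 * s)))
  have h1 : ∫ f, F f ∂ν = ∫ f, F (act m (GTilde.rotation (Real.pi / (2 * s))) f) ∂ν := by
    conv_lhs => rw [← hp.map_eq]
    exact integral_map hp.measurable.aemeasurable hF.aestronglyMeasurable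
  have h2 : Complex.exp (((-2 * s * (Real.pi / (2 * s)) : ℝ) : ℂ) * Complex.I) = -1 := by
    have : -2 * s * (Real.pi / (2 * s)) = -Real.pi := by field_simp
    rw [this]
    push_cast
    rw [neg_mul, Complex.exp_neg, Complex.exp_pi_mul_I]
    norm_num
  simp_rw [h, h2, integral_const_mul] at h1
  linear_combination h1 / 2

lemma integral_coeff (hm : 0 < m) (hinv : IsInvariant m ν) (n : ℕ) : ∫ f, coeff f n ∂ν = 0 :=
  integral_eq_zero_of_rotation hinv (s := m + n) (by positivity) (by fun_prop) fun θ f =>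
    coeff_act_rotation m θ f n

lemma integral_coeff_mul_coeff (hm : 0 < m) (hinv : IsInvariant m ν) (n k : ℕ) :
    ∫ f, coeff f n * coeff f k ∂ν = 0 :=
  integral_eq_zero_of_rotation hinv (s := (m + n) + (m + k)) (by positivity) (by fun_prop)
    fun θ f => by
      rw [coeff_act_rotation, coeff_act_rotation, mul_mul_mul_comm, ← Complex.exp_add]
      congr 2
      push_cast
      ring

lemma integral_coeff_mul_conj_coeff (hinv : IsInvariant m ν) {n k : ℕ} (hnk : n ≠ k) :
    ∫ f, coeff f n * conj (coeff f k) ∂ν = 0 :=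
  integral_eq_zero_of_rotation hinv (s := (n : ℝ) - k) (by
      rw [sub_ne_zero]
      exact_mod_cast hnk)
    ((measurable_coeff_apply n).mul (Complex.continuous_conj.measurable.comp
      (measurable_coeff_apply k))) fun θ f => by
      rw [coeff_act_rotation, coeff_act_rotation, map_mul, mul_mul_mul_comm, ← Complex.exp_conj,
        ← Complex.exp_add]
      congr 2
      simp only [map_mul, Complex.conj_ofReal, Complex.conj_I]
      push_cast
      ring

lemma continuous_eval_prod : Continuous fun p : Hol × Disc => extend p.1.1 p.2 := by
  simp_rw [extend_coe]
  exact continuous_eval.comp (continuous_val.prodMap continuous_id)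

/-- Invariance under the boost transports the second moment from the origin to `z`. The extended
integral allows this before any finiteness is known. -/
lemma lintegral_extend (hinv : IsInvariant m ν) {z : ℂ} (hz : ‖z‖ < 1) :
    ∫⁻ f, ENNReal.ofReal (‖extend f.1 z‖ ^ 2) ∂ν =
      ENNReal.ofReal ((1 - ‖z‖ ^ 2) ^ (-(2 * m))) * ∫⁻ f, ENNReal.ofReal (‖coeff f 0‖ ^ 2) ∂ν := by
  have h : 0 < 1 - ‖z‖ ^ 2 := by nlinarith [norm_nonneg z]
  have hp := hinv (GTilde.boost z hz)
  have h1 : ∫⁻ f, ENNReal.ofReal (‖coeff f 0‖ ^ 2) ∂ν =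
      ∫⁻ f, ENNReal.ofReal (‖coeff (act m (GTilde.boost z hz) f) 0‖ ^ 2) ∂ν := by
    conv_lhs => rw [← hp.map_eq]
    exact lintegral_map (by fun_prop) hp.measurable
  rw [h1, ← lintegral_const_mul' _ _ ENNReal.ofReal_ne_top]
  refine lintegral_congr fun f => ?_
  rw [norm_act_boost_zero, ← ENNReal.ofReal_mul (by positivity), ← mul_assoc,
    ← Real.rpow_add h, neg_add_cancel, Real.rpow_zero, one_mul]

/-- Integrate `lintegral_extend` over the circle of radius `r`. Tonelli exchanges the angle with
`ν`, and Parseval expands the inner integral. -/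
lemma tsum_lintegral_coeff [SFinite ν] (hinv : IsInvariant m ν) {r : ℝ} (h0 : 0 ≤ r) (hr : r < 1) :
    ∑' n, ENNReal.ofReal (r ^ (2 * n)) * ∫⁻ f, ENNReal.ofReal (‖coeff f n‖ ^ 2) ∂ν =
      ENNReal.ofReal ((1 - r ^ 2) ^ (-(2 * m))) *
        ∫⁻ f, ENNReal.ofReal (‖coeff f 0‖ ^ 2) ∂ν := by
  have hz : ∀ θ : ℝ, ‖(r : ℂ) * Complex.exp (θ * Complex.I)‖ = r := fun θ => by
    rw [norm_mul, Complex.norm_exp_ofReal_mul_I, mul_one, Complex.norm_real,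
      Real.norm_of_nonneg h0]
  have hz1 : ∀ θ : ℝ, ‖(r : ℂ) * Complex.exp (θ * Complex.I)‖ < 1 := fun θ => (hz θ).trans_lt hr
  let p : ℝ → Disc := fun θ => ⟨r * Complex.exp (θ * Complex.I), mem_ball_zero_iff.2 (hz1 θ)⟩
  have hp : Continuous p := Continuous.subtype_mk (by fun_prop) _
  have hjoint : Continuous fun q : Hol × ℝ => extend q.1.1 (r * Complex.exp (q.2 * Complex.I)) :=
    continuous_eval_prod.comp (continuous_id.prodMap hp)
  have hpar : ∀ f : Hol, ∑' n, ENNReal.ofReal (2 * Real.pi) *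
      (ENNReal.ofReal (r ^ (2 * n)) * ENNReal.ofReal (‖coeff f n‖ ^ 2)) =
      ∫⁻ θ in Set.Ioc 0 (2 * Real.pi),
        ENNReal.ofReal (‖extend f.1 (r * Complex.exp (θ * Complex.I))‖ ^ 2) := fun f => by
    have hc : Continuous fun θ : ℝ => extend f.1 (r * Complex.exp (θ * Complex.I)) :=
      ((f.1 : C(Disc, ℂ)).continuous.comp hp).congr fun θ => (extend_coe f.1 (p θ)).symm
    have h1 := hasSum_parseval (u := fun n => coeff f n * r ^ n)
      ((summable_norm_coeff f h0 hr).congr fun n => by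
        rw [norm_mul, norm_pow, Complex.norm_real, Real.norm_of_nonneg h0]) hc fun θ => by
        refine (hasSum_coeff f (hz1 θ)).congr_fun fun n => ?_
        rw [mul_pow, ← Complex.exp_nat_mul, mul_assoc]
    have h3 : ∫⁻ θ in Set.Ioc 0 (2 * Real.pi),
        ENNReal.ofReal (‖extend f.1 (r * Complex.exp (θ * Complex.I))‖ ^ 2) =
        ENNReal.ofReal (∫ θ in (0 : ℝ)..2 * Real.pi,
          ‖extend f.1 (r * Complex.exp (θ * Complex.I))‖ ^ 2) := by
      rw [intervalIntegral.integral_of_le Real.two_pi_pos.le]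
      exact (ofReal_integral_eq_lintegral_ofReal ((hc.norm.pow 2).integrableOn_Ioc)
        (Eventually.of_forall fun θ => sq_nonneg _)).symm
    rw [h3, ← h1.tsum_eq, ENNReal.ofReal_tsum_of_nonneg (fun n => by positivity) h1.summable]
    refine tsum_congr fun n => ?_
    rw [← ENNReal.ofReal_mul (by positivity), ← ENNReal.ofReal_mul (by positivity), norm_mul,
      norm_pow, Complex.norm_real, Real.norm_of_nonneg h0]
    congr 1
    ring
  have h2 : ∫⁻ f, ∑' n, ENNReal.ofReal (2 * Real.pi) *
      (ENNReal.ofReal (r ^ (2 * n)) * ENNReal.ofReal (‖coeff f n‖ ^ 2)) ∂ν =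
      ENNReal.ofReal (2 * Real.pi) * (ENNReal.ofReal ((1 - r ^ 2) ^ (-(2 * m))) *
        ∫⁻ f, ENNReal.ofReal (‖coeff f 0‖ ^ 2) ∂ν) := by
    simp_rw [hpar]
    rw [lintegral_lintegral_swap]
    · simp_rw [lintegral_extend hinv (hz1 _), hz]
      rw [lintegral_const]
      simp [mul_comm]
    · exact (ENNReal.measurable_ofReal.comp (hjoint.norm.pow 2).measurable).aemeasurable
  rw [lintegral_tsum fun n => by fun_prop] at h2
  simp_rw [lintegral_const_mul' _ _ ENNReal.ofReal_ne_top] at h2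
  rw [ENNReal.tsum_mul_left] at h2
  exact (ENNReal.mul_right_inj (by simp [Real.pi_pos]) ENNReal.ofReal_ne_top).1 h2

lemma integral_norm_sq_coeff [SFinite ν] (hm : 0 < m) (hinv : IsInvariant m ν)
    (h2 : ∀ n, MemLp (fun f => coeff f n) 2 ν) (n : ℕ) :
    ∫ f, ‖coeff f n‖ ^ 2 ∂ν = (weight m n)⁻¹ * ∫ f, ‖coeff f 0‖ ^ 2 ∂ν := by
  set c : ℕ → ℝ := fun n => ∫ f, ‖coeff f n‖ ^ 2 ∂ν with hc
  have hc0 : ∀ n, 0 ≤ c n := fun n => integral_nonneg fun f => by positivity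
  have hcl : ∀ n, ∫⁻ f, ENNReal.ofReal (‖coeff f n‖ ^ 2) ∂ν = ENNReal.ofReal (c n) := fun n =>
    (ofReal_integral_eq_lintegral_ofReal ((h2 n).integrable_norm_pow two_ne_zero)
      (Eventually.of_forall fun f => by positivity)).symm
  -- Both sides of the circle identity are power series in `x = r²`, so their coefficients can be
  -- compared.
  have key : (fun n => ((c n - (weight m n)⁻¹ * c 0 : ℝ) : ℂ)) = 0 := by
    refine eq_zero_of_hasSum_zero _ fun x hx0 hx1 => ?_
    have h := tsum_lintegral_coeff hinv (Real.sqrt_nonneg x)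
      (by rw [Real.sqrt_lt' one_pos]; simpa using hx1)
    simp_rw [pow_mul, Real.sq_sqrt hx0.le, hcl] at h
    have hpos : 0 ≤ (1 - x) ^ (-(2 * m)) := Real.rpow_nonneg (by linarith) _
    rw [← ENNReal.ofReal_mul hpos] at h
    have h3 : HasSum (fun n => x ^ n * c n) ((1 - x) ^ (-(2 * m)) * c 0) := by
      simp_rw [← ENNReal.ofReal_mul (pow_nonneg hx0.le _)] at h
      have h4 : Summable fun n => x ^ n * c n := by
        have h5 := ENNReal.summable_toReal (h.trans_ne ENNReal.ofReal_ne_top)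
        exact h5.congr fun n => ENNReal.toReal_ofReal (mul_nonneg (pow_nonneg hx0.le _) (hc0 n))
      rw [← ENNReal.ofReal_tsum_of_nonneg (fun n => mul_nonneg (pow_nonneg hx0.le _) (hc0 n)) h4,
        ENNReal.ofReal_eq_ofReal_iff (tsum_nonneg fun n => mul_nonneg (pow_nonneg hx0.le _) (hc0 n))
          (mul_nonneg hpos (hc0 0))] at h
      exact h ▸ h4.hasSum
    have h6 := h3.sub ((hasSum_inv_weight hm hx0.le hx1).mul_right (c 0))
    rw [sub_self] at h6
    have h7 : HasSum (fun n => ((x ^ n * c n - (weight m n)⁻¹ * x ^ n * c 0 : ℝ) : ℂ))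
        ((0 : ℝ) : ℂ) := Complex.hasSum_ofReal.2 h6
    rw [Complex.ofReal_zero] at h7
    refine h7.congr_fun fun n => ?_
    push_cast
    ring
  have := congrFun key n
  simp only [Pi.zero_apply, Complex.ofReal_eq_zero] at this
  linarith

end Invariant

/-! ### The dual of the Hilbert space -/

section Dual

variable {m : ℝ} {hm : 0 < m}

lemma HL2.hasSum_norm_sq (f : HL2 hm) :
    HasSum (fun n => weight m n * ‖coeff f.incl n‖ ^ 2) (‖f‖ ^ 2) := by
  have h1 : inner ℂ f f = ((‖f‖ ^ 2 : ℝ) : ℂ) := by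
    rw [inner_self_eq_norm_sq_to_K]
    simp
  have h2 : inner ℂ f f =
      ∑' n, (weight m n : ℂ) * (conj (coeff f.incl n) * coeff f.incl n) := rfl
  have h3 : ∀ n, (weight m n : ℂ) * (conj (coeff f.incl n) * coeff f.incl n)
      = ((weight m n * ‖coeff f.incl n‖ ^ 2 : ℝ) : ℂ) := fun n => by
    rw [Complex.conj_mul']
    push_cast
    ring
  simp_rw [h3] at h2
  rw [h1, ← Complex.ofReal_tsum, Complex.ofReal_inj] at h2
  rw [h2]
  exact f.summable_sq.hasSum

lemma coeff_zero (n : ℕ) : coeff 0 n = 0 := by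
  simpa using coeff_smul 0 0 n

lemma coeff_sum {ι : Type*} (s : Finset ι) (F : ι → Hol) (n : ℕ) :
    coeff (∑ i ∈ s, F i) n = ∑ i ∈ s, coeff (F i) n := by
  classical
  induction s using Finset.induction_on with
  | empty => simp [coeff_zero]
  | insert i s hi ih => rw [Finset.sum_insert hi, Finset.sum_insert hi, coeff_add, ih]

lemma coeff_sum_smul_monomial (x : ℕ → ℂ) (N n : ℕ) :
    coeff (HL2.incl (∑ k ∈ Finset.range N, x k • HL2.monomial hm k)) n =
      if n < N then x n else 0 := by
  have h : ∀ k, coeff (HL2.incl (HL2.monomial hm k)) n = if n = k then 1 else 0 := fun k =>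
    coeff_monomial k n
  simp_rw [map_sum, map_smul, coeff_sum, coeff_smul, h]
  simp

lemma norm_sq_sum_smul_monomial (x : ℕ → ℂ) (N : ℕ) :
    ‖∑ k ∈ Finset.range N, x k • HL2.monomial hm k‖ ^ 2 =
      ∑ k ∈ Finset.range N, weight m k * ‖x k‖ ^ 2 := by
  refine (HL2.hasSum_norm_sq _).unique ?_
  simp_rw [coeff_sum_smul_monomial]
  convert hasSum_sum_of_ne_finset_zero (L := .unconditional ℕ) (s := Finset.range N) ?_ using 1
  · exact Finset.sum_congr rfl fun k hk => by rw [if_pos (Finset.mem_range.1 hk)]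
  · intro k hk
    rw [if_neg (by simpa using hk)]
    simp

lemma tendsto_sum_smul_monomial (f : HL2 hm) :
    Tendsto (fun N => ∑ k ∈ Finset.range N, coeff f.incl k • HL2.monomial hm k) atTop (𝓝 f) := by
  rw [tendsto_iff_norm_sub_tendsto_zero]
  have h : ∀ N, ‖∑ k ∈ Finset.range N, coeff f.incl k • HL2.monomial hm k - f‖ ^ 2 =
      ‖f‖ ^ 2 - ∑ k ∈ Finset.range N, weight m k * ‖coeff f.incl k‖ ^ 2 := fun N => by
    refine (HL2.hasSum_norm_sq _).unique ?_
    have h1 : HasSum (fun n => if n < N then weight m n * ‖coeff f.incl n‖ ^ 2 else 0)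
        (∑ k ∈ Finset.range N, weight m k * ‖coeff f.incl k‖ ^ 2) := by
      convert hasSum_sum_of_ne_finset_zero (L := .unconditional ℕ) (s := Finset.range N) ?_ using 1
      · exact Finset.sum_congr rfl fun k hk => by rw [if_pos (Finset.mem_range.1 hk)]
      · intro k hk
        rw [if_neg (by simpa using hk)]
    refine ((HL2.hasSum_norm_sq f).sub h1).congr_fun fun n => ?_
    rw [map_sub, coeff_sub, coeff_sum_smul_monomial]
    split_ifs <;> simp
  have h2 : Tendsto (fun N => ‖∑ k ∈ Finset.range N, coeff f.incl k • HL2.monomial hm k - f‖ ^ 2)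
      atTop (𝓝 0) := by
    simp_rw [h]
    rw [← sub_self (‖f‖ ^ 2)]
    exact tendsto_const_nhds.sub (HL2.hasSum_norm_sq f).tendsto_sum_nat
  have h3 := h2.sqrt
  simpa [Real.sqrt_sq (norm_nonneg _)] using h3

lemma sum_norm_sq_dual_le (φ : StrongDual ℂ (HL2 hm)) (N : ℕ) :
    ∑ n ∈ Finset.range N, (weight m n)⁻¹ * ‖φ (HL2.monomial hm n)‖ ^ 2 ≤ ‖φ‖ ^ 2 := by
  set S := ∑ n ∈ Finset.range N, (weight m n)⁻¹ * ‖φ (HL2.monomial hm n)‖ ^ 2 with hS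
  have hS0 : 0 ≤ S := Finset.sum_nonneg fun n _ =>
    mul_nonneg (inv_pos.2 (weight_pos hm n)).le (sq_nonneg _)
  -- These are the coefficients of the Riesz representative of `φ`. On its truncation `φ` takes the
  -- value `S`, which is also its squared norm, hence `S ≤ ‖φ‖ √S`.
  set x : ℕ → ℂ := fun n => (weight m n : ℂ)⁻¹ * conj (φ (HL2.monomial hm n)) with hx
  have h1 : φ (∑ k ∈ Finset.range N, x k • HL2.monomial hm k) = (S : ℂ) := by
    rw [map_sum, hS, Complex.ofReal_sum]
    refine Finset.sum_congr rfl fun n _ => ?_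
    rw [map_smul, smul_eq_mul, hx, mul_assoc, Complex.conj_mul']
    push_cast
    ring
  have h2 : ‖∑ k ∈ Finset.range N, x k • HL2.monomial hm k‖ ^ 2 = S := by
    rw [norm_sq_sum_smul_monomial]
    refine Finset.sum_congr rfl fun n _ => ?_
    have hw := (weight_pos hm n).ne'
    rw [hx, norm_mul, norm_inv, Complex.norm_real, Real.norm_of_nonneg (weight_pos hm n).le,
      RCLike.norm_conj]
    field_simp
  have h3 := φ.le_opNorm (∑ k ∈ Finset.range N, x k • HL2.monomial hm k)
  rw [h1, Complex.norm_real, Real.norm_of_nonneg hS0] at h3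
  have h4 : S ^ 2 ≤ ‖φ‖ ^ 2 * S := by
    rw [← h2] at h3 ⊢
    nlinarith [norm_nonneg (∑ k ∈ Finset.range N, x k • HL2.monomial hm k), norm_nonneg φ]
  rcases hS0.eq_or_lt with h0 | h0
  · rw [← h0]
    positivity
  · nlinarith

/-- The lower bound for `‖φ‖` comes from truncated Riesz representatives, the upper bound from
Cauchy–Schwarz on Taylor polynomials and their density. Completeness of `HL2` plays no part. -/
lemma hasSum_norm_sq_dual (φ : StrongDual ℂ (HL2 hm)) :
    HasSum (fun n => (weight m n)⁻¹ * ‖φ (HL2.monomial hm n)‖ ^ 2) (‖φ‖ ^ 2) := by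
  have hnn : ∀ n, 0 ≤ (weight m n)⁻¹ * ‖φ (HL2.monomial hm n)‖ ^ 2 := fun n =>
    mul_nonneg (inv_pos.2 (weight_pos hm n)).le (sq_nonneg _)
  have hs := summable_of_sum_range_le hnn (sum_norm_sq_dual_le φ)
  set S := ∑' n, (weight m n)⁻¹ * ‖φ (HL2.monomial hm n)‖ ^ 2 with hS
  have hS0 : 0 ≤ S := tsum_nonneg hnn
  have h1 : S ≤ ‖φ‖ ^ 2 := Real.tsum_le_of_sum_range_le hnn (sum_norm_sq_dual_le φ)
  have h2 : ‖φ‖ ≤ √S := by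
    refine φ.opNorm_le_bound (Real.sqrt_nonneg _) fun f => ?_
    have h3 := ((φ.continuous.tendsto f).comp (tendsto_sum_smul_monomial f)).norm
    refine le_of_tendsto h3 (Eventually.of_forall fun N => ?_)
    simp only [Function.comp_apply, map_sum, map_smul, smul_eq_mul]
    have hw := fun n => weight_pos hm n
    calc ‖∑ k ∈ Finset.range N, coeff f.incl k * φ (HL2.monomial hm k)‖
        ≤ ∑ k ∈ Finset.range N, (√(weight m k)⁻¹ * ‖φ (HL2.monomial hm k)‖) *
          (√(weight m k) * ‖coeff f.incl k‖) := by
          refine (norm_sum_le _ _).trans (Finset.sum_le_sum fun k _ => le_of_eq ?_)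
          rw [norm_mul, Real.sqrt_inv]
          have := (Real.sqrt_pos.2 (hw k)).ne'
          field_simp
      _ ≤ √(∑ k ∈ Finset.range N, (√(weight m k)⁻¹ * ‖φ (HL2.monomial hm k)‖) ^ 2) *
          √(∑ k ∈ Finset.range N, (√(weight m k) * ‖coeff f.incl k‖) ^ 2) :=
          Real.sum_mul_le_sqrt_mul_sqrt _ _ _
      _ ≤ √S * √(‖f‖ ^ 2) := by
          simp_rw [mul_pow, Real.sq_sqrt (hw _).le, Real.sq_sqrt (inv_pos.2 (hw _)).le]
          gcongr
          · exact hs.sum_le_tsum _ fun n _ => hnn n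
          · exact sum_le_hasSum _ (fun n _ => mul_nonneg (hw n).le (sq_nonneg _))
              (HL2.hasSum_norm_sq f)
      _ = √S * ‖f‖ := by rw [Real.sqrt_sq (norm_nonneg _)]
  have h4 : ‖φ‖ ^ 2 ≤ S := by
    rw [← Real.sq_sqrt hS0]
    gcongr
  rw [← le_antisymm h1 h4]
  exact hs.hasSum

/-- The functional `f ↦ f_n` on `H^m ∩ L²`. -/
def coeffDual (hm : 0 < m) (n : ℕ) : StrongDual ℂ (HL2 hm) :=
  LinearMap.mkContinuous
    { toFun := fun f => coeff f.incl n
      map_add' := fun f g => by rw [map_add, coeff_add]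
      map_smul' := fun c f => by rw [map_smul, coeff_smul]; rfl } (√(weight m n))⁻¹ fun f => by
    have hw := weight_pos hm n
    have h := sum_le_hasSum {n} (fun k _ => mul_nonneg (weight_pos hm k).le (sq_nonneg _))
      (HL2.hasSum_norm_sq f)
    rw [Finset.sum_singleton] at h
    change ‖coeff f.incl n‖ ≤ _
    rw [inv_mul_eq_div, le_div_iff₀ (Real.sqrt_pos.2 hw)]
    refine (sq_le_sq₀ (by positivity) (norm_nonneg _)).1 ?_
    rw [mul_pow, Real.sq_sqrt hw.le]
    linarith

/-! ### Finite linear combinations of Taylor coefficients -/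

/-- The functional `f ↦ ∑_{i < N} a_i f_i`. -/
def linComb (a : ℕ → ℂ) (N : ℕ) (f : Hol) : ℂ := ∑ i ∈ Finset.range N, a i * coeff f i

@[fun_prop]
lemma measurable_linComb (a : ℕ → ℂ) (N : ℕ) : Measurable (linComb a N) := by
  unfold linComb
  fun_prop

lemma linComb_add (a : ℕ → ℂ) (N : ℕ) (f g : Hol) :
    linComb a N (f + g) = linComb a N f + linComb a N g := by
  simp [linComb, coeff_add, mul_add, Finset.sum_add_distrib]

lemma linComb_smul (a : ℕ → ℂ) (N : ℕ) (c : ℂ) (f : Hol) :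
    linComb a N (c • f) = c * linComb a N f := by
  simp [linComb, coeff_smul, Finset.mul_sum, mul_left_comm]

lemma partialEval_eq_linComb (φ : StrongDual ℂ (HL2 hm)) (N : ℕ) :
    partialEval φ N = linComb (fun n => φ (HL2.monomial hm n)) N := by
  funext f
  simp [partialEval, linComb, mul_comm]

/-- The partial evaluations are constant once `N > n`. Through this lemma the moment hypothesis on
functionals reaches the coefficients. -/
lemma isVersion_coeffDual (ν : Measure Hol) [IsFiniteMeasure ν] (n : ℕ) :
    IsVersion ν (coeffDual hm n) fun f => coeff f n := by
  refine ⟨(measurable_coeff_apply n).aemeasurable, ?_⟩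
  refine tendstoInMeasure_of_tendsto_ae
    (fun N => by rw [partialEval_eq_linComb]; exact (measurable_linComb _ _).aestronglyMeasurable)
    (Eventually.of_forall fun f => ?_)
  refine tendsto_const_nhds.congr' ?_
  filter_upwards [eventually_gt_atTop n] with N hN
  have h : ∀ k, coeffDual hm n (HL2.monomial hm k) = if n = k then 1 else 0 := fun k =>
    coeff_monomial k n
  rw [partialEval_eq_linComb]
  simp [linComb, h, hN]

end Dual

/-! ### Moments of finite linear combinations under an invariant measure -/

section Moments

variable {m : ℝ} {ν : Measure Hol}

lemma memLp_linComb (h2 : ∀ n, MemLp (fun f => coeff f n) 2 ν) (a : ℕ → ℂ) (N : ℕ) :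
    MemLp (linComb a N) 2 ν :=
  memLp_finsetSum _ fun i _ => (h2 i).const_mul (a i)

lemma integral_linComb [IsFiniteMeasure ν] (hm : 0 < m) (hinv : IsInvariant m ν)
    (h2 : ∀ n, MemLp (fun f => coeff f n) 2 ν) (a : ℕ → ℂ) (N : ℕ) :
    ∫ f, linComb a N f ∂ν = 0 := by
  unfold linComb
  rw [integral_finsetSum _ fun i _ => ((h2 i).integrable one_le_two).const_mul (a i)]
  simp [integral_const_mul, integral_coeff hm hinv]

/-- With centring, the vanishing of `E L²` says that `Re L` and `Im L` are uncorrelated with equal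
variances, as for a circular Gaussian. -/
lemma integral_linComb_sq (hm : 0 < m) (hinv : IsInvariant m ν)
    (h2 : ∀ n, MemLp (fun f => coeff f n) 2 ν) (a : ℕ → ℂ) (N : ℕ) :
    ∫ f, linComb a N f ^ 2 ∂ν = 0 := by
  have h : ∀ f, linComb a N f ^ 2 = ∑ i ∈ Finset.range N, ∑ j ∈ Finset.range N,
      (a i * a j) * (coeff f i * coeff f j) := fun f => by
    rw [sq, linComb, Finset.sum_mul_sum]
    exact Finset.sum_congr rfl fun i _ => Finset.sum_congr rfl fun j _ => by ring
  have hi : ∀ i j, Integrable (fun f => (a i * a j) * (coeff f i * coeff f j)) ν := fun i j =>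
    ((h2 i).integrable_mul (h2 j)).const_mul _
  simp_rw [h]
  rw [integral_finsetSum _ fun i _ => integrable_finsetSum _ fun j _ => hi i j]
  refine Finset.sum_eq_zero fun i _ => ?_
  rw [integral_finsetSum _ fun j _ => hi i j]
  exact Finset.sum_eq_zero fun j _ => by
    rw [integral_const_mul, integral_coeff_mul_coeff hm hinv, mul_zero]

lemma integral_norm_sq_linComb [SFinite ν] (hm : 0 < m) (hinv : IsInvariant m ν)
    (h2 : ∀ n, MemLp (fun f => coeff f n) 2 ν) (a : ℕ → ℂ) (N : ℕ) :
    ∫ f, ‖linComb a N f‖ ^ 2 ∂ν =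
      (∫ f, ‖coeff f 0‖ ^ 2 ∂ν) * ∑ i ∈ Finset.range N, (weight m i)⁻¹ * ‖a i‖ ^ 2 := by
  have h : ∀ f, ((‖linComb a N f‖ ^ 2 : ℝ) : ℂ) = ∑ i ∈ Finset.range N, ∑ j ∈ Finset.range N,
      (a i * conj (a j)) * (coeff f i * conj (coeff f j)) := fun f => by
    push_cast
    rw [← Complex.mul_conj', linComb, map_sum, Finset.sum_mul_sum]
    exact Finset.sum_congr rfl fun i _ => Finset.sum_congr rfl fun j _ => by
      rw [map_mul]
      ring
  have hi : ∀ i j, Integrable (fun f => (a i * conj (a j)) * (coeff f i * conj (coeff f j))) ν :=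
    fun i j => ((h2 i).integrable_mul (h2 j).star).const_mul _
  have key : ((∫ f, ‖linComb a N f‖ ^ 2 ∂ν : ℝ) : ℂ) =
      (((∫ f, ‖coeff f 0‖ ^ 2 ∂ν) * ∑ i ∈ Finset.range N, (weight m i)⁻¹ * ‖a i‖ ^ 2 : ℝ) : ℂ) := by
    rw [← integral_complex_ofReal]
    simp_rw [h]
    rw [integral_finsetSum _ fun i _ => integrable_finsetSum _ fun j _ => hi i j, Finset.mul_sum,
      Complex.ofReal_sum]
    refine Finset.sum_congr rfl fun i hiN => ?_
    rw [integral_finsetSum _ fun j _ => hi i j, Finset.sum_eq_single i]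
    · have h3 : ∀ f, coeff f i * conj (coeff f i) = ((‖coeff f i‖ ^ 2 : ℝ) : ℂ) := fun f => by
        rw [Complex.mul_conj']
        push_cast
        rfl
      rw [integral_const_mul]
      simp_rw [h3]
      rw [integral_complex_ofReal, integral_norm_sq_coeff hm hinv h2, Complex.mul_conj']
      push_cast
      ring
    · intro j _ hji
      rw [integral_const_mul, integral_coeff_mul_conj_coeff hinv hji.symm, mul_zero]
    · exact fun hiN' => absurd hiN hiN'
  exact_mod_cast key

end Moments

/-! ### Scaled convolutions -/

section Convolution

/-- `L` is centred and square integrable under `μ`, with `E ‖L‖ ^ 2 = V`. -/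
structure IsCentred (μ : Measure Hol) (L : Hol → ℂ) (V : ℝ) : Prop where
  memLp : MemLp L 2 μ
  integral_eq_zero : ∫ f, L f ∂μ = 0
  integral_norm_sq : ∫ f, ‖L f‖ ^ 2 ∂μ = V

/-- Under the product measure the cross term factors into a product of means, which vanishes. -/
lemma IsCentred.conv {μ ρ : Measure Hol} [IsProbabilityMeasure μ] [IsProbabilityMeasure ρ]
    {L : Hol → ℂ} (hL : Measurable L) (hadd : ∀ f g, L (f + g) = L f + L g) {V W : ℝ}
    (h1 : IsCentred μ L V) (h2 : IsCentred ρ L W) : IsCentred (μ.conv ρ) L (V + W) := by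
  have ha : Measurable fun p : Hol × Hol => p.1 + p.2 := measurable_add
  have e1 : MemLp (fun p : Hol × Hol => L p.1) 2 (μ.prod ρ) := h1.memLp.comp_fst ρ
  have e2 : MemLp (fun p : Hol × Hol => L p.2) 2 (μ.prod ρ) := h2.memLp.comp_snd μ
  refine ⟨?_, ?_, ?_⟩
  · rw [Measure.conv, memLp_map_measure_iff hL.aestronglyMeasurable ha.aemeasurable]
    exact (e1.add e2).ae_eq (Eventually.of_forall fun p => (hadd p.1 p.2).symm)
  · rw [Measure.conv, integral_map ha.aemeasurable hL.aestronglyMeasurable]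
    simp_rw [hadd]
    rw [integral_add (e1.integrable one_le_two) (e2.integrable one_le_two), integral_fun_fst,
      integral_fun_snd, h1.integral_eq_zero, h2.integral_eq_zero]
    simp
  · rw [Measure.conv, integral_map ha.aemeasurable (hL.norm.pow_const 2).aestronglyMeasurable]
    have h : ∀ p : Hol × Hol, ‖L (p.1 + p.2)‖ ^ 2 =
        ‖L p.1‖ ^ 2 + ‖L p.2‖ ^ 2 + 2 * (L p.1 * conj (L p.2)).re := fun p => by
      rw [hadd, Complex.sq_norm, Complex.sq_norm, Complex.sq_norm, Complex.normSq_add]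
    have i3 : Integrable (fun p : Hol × Hol => L p.1 * conj (L p.2)) (μ.prod ρ) :=
      e1.integrable_mul e2.star
    have i4 : Integrable (fun p : Hol × Hol => ‖L p.1‖ ^ 2 + ‖L p.2‖ ^ 2) (μ.prod ρ) :=
      (e1.integrable_norm_pow two_ne_zero).add (e2.integrable_norm_pow two_ne_zero)
    have i5 : Integrable (fun p : Hol × Hol => 2 * (L p.1 * conj (L p.2)).re) (μ.prod ρ) :=
      i3.re.const_mul 2
    have j1 : ∫ p : Hol × Hol, ‖L p.1‖ ^ 2 ∂(μ.prod ρ) = V := by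
      rw [← h1.integral_norm_sq]
      simpa using integral_fun_fst (μ := μ) (ν := ρ) fun f => ‖L f‖ ^ 2
    have j2 : ∫ p : Hol × Hol, ‖L p.2‖ ^ 2 ∂(μ.prod ρ) = W := by
      rw [← h2.integral_norm_sq]
      simpa using integral_fun_snd (μ := μ) (ν := ρ) fun f => ‖L f‖ ^ 2
    simp_rw [h]
    rw [integral_add i4 i5,
      integral_add (e1.integrable_norm_pow two_ne_zero) (e2.integrable_norm_pow two_ne_zero),
      integral_const_mul, j1, j2]
    have h3 : ∫ p : Hol × Hol, (L p.1 * conj (L p.2)).re ∂(μ.prod ρ) =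
        (∫ p : Hol × Hol, L p.1 * conj (L p.2) ∂(μ.prod ρ)).re := integral_re i3
    rw [h3, integral_prod_mul L (fun g => conj (L g)), h1.integral_eq_zero]
    simp

variable {ν : Measure Hol} [IsProbabilityMeasure ν] {L : Hol → ℂ}

lemma IsCentred.convPow (hL : Measurable L) (hadd : ∀ f g, L (f + g) = L f + L g) {V : ℝ}
    (h : IsCentred ν L V) (n : ℕ) : IsCentred (convPow ν n) L (n * V) := by
  induction n with
  | zero =>
    have h0 : L 0 = 0 := by simpa using hadd 0 0
    have hae : L =ᵐ[HolDiff.convPow ν 0] 0 := by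
      change L =ᵐ[Measure.dirac 0] 0
      rw [Filter.EventuallyEq, ae_dirac_iff (measurableSet_eq_fun hL measurable_zero)]
      exact h0
    refine ⟨MemLp.zero.ae_eq hae.symm, ?_, ?_⟩
    · rw [integral_congr_ae hae]
      simp
    · have : (fun f => ‖L f‖ ^ 2) =ᵐ[HolDiff.convPow ν 0] 0 := hae.mono fun f hf => by simp [hf]
      rw [integral_congr_ae this]
      simp
  | succ n ih =>
    have := IsCentred.conv hL hadd ih h
    rw [Nat.cast_succ, add_mul, one_mul]
    exact this

lemma measurable_smul_const (c : ℂ) : Measurable fun f : Hol => c • f :=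
  (continuous_const_smul c).measurable

/-- The constant stays unsimplified because of `n = 0`: it equals `V` for `n > 0` but `0` for `n =
0`, where `(√0)⁻¹ = 0`. -/
lemma IsCentred.scaledConv (hL : Measurable L) (hadd : ∀ f g, L (f + g) = L f + L g)
    (hsmul : ∀ (c : ℂ) f, L (c • f) = c * L f) {V : ℝ} (h : IsCentred ν L V) (n : ℕ) :
    IsCentred (scaledConv ν n) L ((√n)⁻¹ ^ 2 * (n * V)) := by
  have hc := h.convPow hL hadd n
  have hs : ∀ f, L (((√(n : ℝ))⁻¹ : ℂ) • f) = ((√(n : ℝ))⁻¹ : ℂ) * L f := fun f => hsmul _ f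
  refine ⟨?_, ?_, ?_⟩
  · rw [HolDiff.scaledConv, memLp_map_measure_iff hL.aestronglyMeasurable
      (measurable_smul_const _).aemeasurable]
    exact (hc.memLp.const_mul _).ae_eq (Eventually.of_forall fun f => (hs f).symm)
  · rw [HolDiff.scaledConv, integral_map (measurable_smul_const _).aemeasurable
      hL.aestronglyMeasurable]
    simp_rw [hs]
    rw [integral_const_mul, hc.integral_eq_zero, mul_zero]
  · rw [HolDiff.scaledConv, integral_map (measurable_smul_const _).aemeasurable
      (hL.norm.pow_const 2).aestronglyMeasurable]
    simp_rw [hs, norm_mul, mul_pow]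
    rw [integral_const_mul, hc.integral_norm_sq, norm_inv, Complex.norm_real, Real.norm_eq_abs,
      abs_of_nonneg (Real.sqrt_nonneg _)]

lemma charFun_map_convPow (hL : Measurable L) (hadd : ∀ f g, L (f + g) = L f + L g) (n : ℕ)
    (t : ℂ) : charFun ((convPow ν n).map L) t = charFun (ν.map L) t ^ n := by
  induction n with
  | zero =>
    have h0 : L 0 = 0 := by simpa using hadd 0 0
    change charFun ((Measure.dirac 0).map L) t = _
    rw [Measure.map_dirac' hL, h0]
    simp
  | succ n ih =>
    have h : ((convPow ν n).conv ν).map L = ((convPow ν n).map L).conv (ν.map L) :=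
      Measure.map_conv_addMonoidHom (AddMonoidHom.mk' L hadd) hL
    have : IsProbabilityMeasure ((convPow ν n).map L) :=
      Measure.isProbabilityMeasure_map hL.aemeasurable
    have : IsProbabilityMeasure (ν.map L) := Measure.isProbabilityMeasure_map hL.aemeasurable
    change charFun (((convPow ν n).conv ν).map L) t = _
    rw [h, charFun_conv, ih, pow_succ]

lemma charFun_map_scaledConv (hL : Measurable L) (hadd : ∀ f g, L (f + g) = L f + L g)
    (hsmul : ∀ (c : ℂ) f, L (c • f) = c * L f) (n : ℕ) (t : ℂ) :
    charFun ((scaledConv ν n).map L) t = charFun (ν.map L) ((√n)⁻¹ • t) ^ n := by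
  rw [scaledConv, Measure.map_map hL (measurable_smul_const _),
    ← charFun_map_convPow hL hadd, ← charFun_map_smul_comp hL.aemeasurable]
  congr 2
  funext f
  simp [hsmul]

end Convolution

/-! ### The central limit theorem for a complex functional -/

lemma tendsto_charFun_map_pow {Ω : Type*} [MeasurableSpace Ω] {P : Measure Ω}
    [IsProbabilityMeasure P] {X : Ω → ℝ} (hX : MemLp X 2 P) (h0 : ∫ ω, X ω ∂P = 0) :
    Tendsto (fun n : ℕ => charFun (P.map X) (√n)⁻¹ ^ n) atTop
      (𝓝 (Complex.exp (-(∫ ω, X ω ^ 2 ∂P : ℝ) / 2))) := by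
  have hm := hX.aestronglyMeasurable.aemeasurable
  set V := ∫ ω, X ω ^ 2 ∂P with hV
  have hV0 : 0 ≤ V := integral_nonneg fun ω => sq_nonneg _
  rcases hV0.eq_or_lt with h | h
  · have hae : X =ᵐ[P] fun _ => 0 := by
      have h1 := (integral_eq_zero_iff_of_nonneg (fun ω => sq_nonneg (X ω)) hX.integrable_sq).1
        h.symm
      filter_upwards [h1] with ω hω
      simpa using hω
    rw [Measure.map_congr hae, ← h]
    simp
  · have hs : 0 < √V := Real.sqrt_pos.2 h
    -- Normalise to unit variance and evaluate at `√V`, which undoes the scaling. The degenerate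
    -- case `V = 0` was split off because it cannot be normalised.
    have h1 := tendsto_charFun_inv_sqrt_mul_pow (P := P) (X := fun ω => (√V)⁻¹ * X ω)
      (hm.const_mul _) (by rw [integral_const_mul, h0, mul_zero]) (by
        simp only [Pi.pow_apply, mul_pow, inv_pow, Real.sq_sqrt hV0]
        rw [integral_const_mul, ← hV, inv_mul_cancel₀ h.ne']) (√V)
    have h2 : ((√V : ℝ) : ℂ) ^ 2 = V := by
      exact_mod_cast Real.sq_sqrt hV0
    rw [h2] at h1
    refine h1.congr fun n => ?_
    rw [charFun_map_mul_comp hm]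
    congr 2
    field_simp

/-- The identity `(Re w)² = |w|²/2 + Re(w²)/2` with `w = conj t * L`: the last term integrates to
zero by `hsq`, so every real direction has the same variance. -/
lemma integral_inner_sq {μ : Measure Hol} {L : Hol → ℂ} {V : ℝ} (h : IsCentred μ L V)
    (hsq : ∫ f, L f ^ 2 ∂μ = 0) (t : ℂ) :
    ∫ f, (inner ℝ (L f) t) ^ 2 ∂μ = ‖t‖ ^ 2 * V / 2 := by
  have h1 : ∀ f, (inner ℝ (L f) t) ^ 2 =
      ‖t‖ ^ 2 / 2 * ‖L f‖ ^ 2 + 1 / 2 * (conj t ^ 2 * L f ^ 2).re := fun f => by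
    rw [Complex.inner, Complex.sq_norm, Complex.sq_norm, Complex.normSq_apply,
      Complex.normSq_apply]
    simp only [sq, Complex.mul_re, Complex.mul_im, Complex.conj_re, Complex.conj_im]
    ring
  have i1 : Integrable (fun f => conj t ^ 2 * L f ^ 2) μ := by
    simp_rw [sq (L _)]
    exact (h.memLp.integrable_mul h.memLp).const_mul _
  have i2 : Integrable (fun f => 1 / 2 * (conj t ^ 2 * L f ^ 2).re) μ := i1.re.const_mul _
  simp_rw [h1]
  rw [integral_add ((h.memLp.integrable_norm_pow two_ne_zero).const_mul _) i2,
    integral_const_mul, integral_const_mul, h.integral_norm_sq]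
  have h3 : ∫ f, (conj t ^ 2 * L f ^ 2).re ∂μ = (∫ f, conj t ^ 2 * L f ^ 2 ∂μ).re := integral_re i1
  rw [h3, integral_const_mul, hsq]
  simp
  ring

/-- Cramér–Wold: at `t` the characteristic function is that of the real variable `⟨L, t⟩`, to which
the scalar central limit theorem applies. -/
lemma tendsto_charFun_scaledConv {ν : Measure Hol} [IsProbabilityMeasure ν] {L : Hol → ℂ}
    (hL : Measurable L) (hadd : ∀ f g, L (f + g) = L f + L g)
    (hsmul : ∀ (c : ℂ) f, L (c • f) = c * L f) {V : ℝ} (h : IsCentred ν L V)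
    (hsq : ∫ f, L f ^ 2 ∂ν = 0) (t : ℂ) :
    Tendsto (fun n => charFun ((scaledConv ν n).map L) t) atTop
      (𝓝 (Complex.exp (-(‖t‖ ^ 2 * V / 2 : ℝ) / 2))) := by
  have hX : MemLp (fun f => inner ℝ (L f) t) 2 ν := h.memLp.inner_const t
  have h0 : ∫ f, inner ℝ (L f) t ∂ν = 0 := by
    simp_rw [real_inner_comm]
    rw [integral_inner (h.memLp.integrable one_le_two), h.integral_eq_zero, inner_zero_right]
  have h1 := tendsto_charFun_map_pow hX h0
  rw [integral_inner_sq h hsq] at h1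
  refine h1.congr fun n => ?_
  rw [charFun_map_scaledConv hL hadd hsmul]
  congr 1
  rw [charFun_apply, charFun_apply, integral_map hX.aestronglyMeasurable.aemeasurable
    (by fun_prop), integral_map hL.aemeasurable (by fun_prop)]
  refine integral_congr_ae (Eventually.of_forall fun f => ?_)
  simp only [inner_smul_right, RCLike.inner_apply, conj_trivial]

/-! ### Complex Gaussian measures -/

section ComplexGaussian

variable (v : ℝ≥0)

lemma measurable_complexGaussian_map : Measurable fun p : ℝ × ℝ => (p.1 : ℂ) + p.2 * Complex.I := by
  fun_prop

instance : IsProbabilityMeasure (complexGaussian v) :=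
  Measure.isProbabilityMeasure_map measurable_complexGaussian_map.aemeasurable

lemma charFun_complexGaussian (t : ℂ) :
    charFun (complexGaussian v) t = Complex.exp (-(v * ‖t‖ ^ 2 : ℝ) / 2) := by
  rw [charFun_apply, complexGaussian, integral_map measurable_complexGaussian_map.aemeasurable
    (by fun_prop)]
  have h : ∀ p : ℝ × ℝ, Complex.exp ((inner ℝ ((p.1 : ℂ) + p.2 * Complex.I) t : ℝ) * Complex.I) =
      Complex.exp (t.re * p.1 * Complex.I) * Complex.exp (t.im * p.2 * Complex.I) := fun p => by
    rw [← Complex.exp_add, Complex.inner]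
    congr 1
    simp [Complex.mul_re]
    ring
  simp_rw [h]
  rw [integral_prod_mul (fun x : ℝ => Complex.exp (t.re * x * Complex.I))
    (fun x : ℝ => Complex.exp (t.im * x * Complex.I)), ← charFun_apply_real, ← charFun_apply_real,
    charFun_gaussianReal, charFun_gaussianReal, ← Complex.exp_add]
  congr 1
  rw [Complex.sq_norm, Complex.normSq_apply]
  push_cast
  ring

lemma memLp_complexGaussian : MemLp (fun z : ℂ => z) 2 (complexGaussian v) := by
  rw [complexGaussian, memLp_map_measure_iff (by fun_prop)
    measurable_complexGaussian_map.aemeasurable]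
  have h : MemLp (fun x : ℝ => (x : ℂ)) 2 (gaussianReal 0 v) := (memLp_id_gaussianReal 2).ofReal
  exact (h.comp_fst _).add ((h.comp_snd _).mul_const _)

lemma integral_complexGaussian : ∫ z, z ∂complexGaussian v = 0 := by
  have h : MemLp (fun x : ℝ => (x : ℂ)) 2 (gaussianReal 0 v) := (memLp_id_gaussianReal 2).ofReal
  have h1 : Integrable (fun x : ℝ => (x : ℂ)) (gaussianReal 0 v) := h.integrable one_le_two
  rw [complexGaussian, integral_map measurable_complexGaussian_map.aemeasurable (by fun_prop),
    integral_add (h1.comp_fst _) ((h1.comp_snd _).mul_const _), integral_mul_const,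
    integral_fun_fst (fun x : ℝ => (x : ℂ)), integral_fun_snd (fun x : ℝ => (x : ℂ)),
    integral_complex_ofReal, integral_id_gaussianReal]
  simp

lemma integral_norm_sq_complexGaussian : ∫ z, ‖z‖ ^ 2 ∂complexGaussian v = 2 * v := by
  have h1 : Integrable (fun x : ℝ => x ^ 2) (gaussianReal 0 v) :=
    (memLp_id_gaussianReal 2).integrable_sq
  have h2 : ∫ x, x ^ 2 ∂gaussianReal 0 v = v := by
    have := variance_fun_id_gaussianReal (μ := 0) (v := v)
    rw [variance_of_integral_eq_zero aemeasurable_id' integral_id_gaussianReal] at this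
    exact this
  have h3 : ∀ p : ℝ × ℝ, ‖(p.1 : ℂ) + p.2 * Complex.I‖ ^ 2 = p.1 ^ 2 + p.2 ^ 2 := fun p => by
    rw [Complex.sq_norm, Complex.normSq_add_mul_I]
  have h4 : ∫ p : ℝ × ℝ, p.1 ^ 2 ∂(gaussianReal 0 v).prod (gaussianReal 0 v) = v := by
    have h := integral_fun_fst (μ := gaussianReal 0 v) (ν := gaussianReal 0 v) fun x : ℝ => x ^ 2
    rw [probReal_univ, one_smul] at h
    exact h.trans h2
  have h5 : ∫ p : ℝ × ℝ, p.2 ^ 2 ∂(gaussianReal 0 v).prod (gaussianReal 0 v) = v := by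
    have h := integral_fun_snd (μ := gaussianReal 0 v) (ν := gaussianReal 0 v) fun x : ℝ => x ^ 2
    rw [probReal_univ, one_smul] at h
    exact h.trans h2
  rw [complexGaussian, integral_map measurable_complexGaussian_map.aemeasurable (by fun_prop)]
  simp_rw [h3]
  rw [integral_add (h1.comp_fst _) (h1.comp_snd _), h4, h5]
  ring

end ComplexGaussian

lemma lintegral_enorm_le_sqrt {Ω : Type*} [MeasurableSpace Ω] {P : Measure Ω}
    [IsProbabilityMeasure P] {X : Ω → ℂ} (hX : MemLp X 2 P) :
    ∫⁻ ω, ‖X ω‖ₑ ∂P ≤ ENNReal.ofReal √(∫ ω, ‖X ω‖ ^ 2 ∂P) := by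
  have h := eLpNorm_le_eLpNorm_of_exponent_le (one_le_two (α := ENNReal)) hX.1
  rw [eLpNorm_one_eq_lintegral_enorm, hX.eLpNorm_eq_integral_rpow_norm two_ne_zero (by simp)] at h
  simpa [Real.sqrt_eq_rpow] using h

/-! ### The Gaussian measure on the space of holomorphic differentials -/

section Gaussian

variable {m : ℝ}

/-- The law of the sequence of Taylor coefficients under `gaussian m T`. -/
def gaussianCoeff (m : ℝ) (T : ℝ≥0) : Measure (ℕ → ℂ) :=
  Measure.infinitePi fun n : ℕ => complexGaussian (T / (weight m n).toNNReal)

instance (T : ℝ≥0) : IsProbabilityMeasure (gaussianCoeff m T) :=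
  inferInstanceAs (IsProbabilityMeasure (Measure.infinitePi _))

lemma map_eval_gaussianCoeff (T : ℝ≥0) (n : ℕ) :
    (gaussianCoeff m T).map (fun x => x n) = complexGaussian (T / (weight m n).toNNReal) :=
  Measure.infinitePi_map_eval _ n

lemma coe_div_weight (hm : 0 < m) (T : ℝ≥0) (n : ℕ) :
    ((T / (weight m n).toNNReal : ℝ≥0) : ℝ) = T * (weight m n)⁻¹ := by
  rw [NNReal.coe_div, Real.coe_toNNReal _ (weight_pos hm n).le, div_eq_mul_inv]

/-- The sum has finite expectation, since `E |x_n| ≤ √(2T / w_n)`. The factor `2` counts the two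
real dimensions. -/
lemma ae_summable_gaussianCoeff (hm : 0 < m) (T : ℝ≥0) {r : ℝ} (h0 : 0 ≤ r) (hr : r < 1) :
    ∀ᵐ x ∂gaussianCoeff m T, Summable fun n => ‖x n‖ * r ^ n := by
  have h1 : ∀ n, ∫⁻ x : ℕ → ℂ, ‖x n‖ₑ ∂gaussianCoeff m T ≤
      ENNReal.ofReal (√(2 * T) * √(weight m n)⁻¹) := fun n => by
    have h2 := lintegral_enorm_le_sqrt (memLp_complexGaussian (T / (weight m n).toNNReal))
    rw [integral_norm_sq_complexGaussian, coe_div_weight hm, ← mul_assoc,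
      Real.sqrt_mul (by positivity), ← map_eval_gaussianCoeff,
      lintegral_map (by fun_prop) (by fun_prop)] at h2
    exact h2
  have hs : Summable fun n => √(2 * T) * √(weight m n)⁻¹ * r ^ n := by
    simp_rw [mul_assoc]
    exact (summable_sqrt_inv_weight hm h0 hr).mul_left _
  have h3 : ∫⁻ x : ℕ → ℂ, ∑' n, ‖x n‖ₑ * ENNReal.ofReal (r ^ n) ∂gaussianCoeff m T ≠ ⊤ := by
    rw [lintegral_tsum fun n =>
      ((measurable_pi_apply n).enorm.mul_const _).aemeasurable]
    refine ne_top_of_le_ne_top hs.tsum_ofReal_ne_top (ENNReal.tsum_le_tsum fun n => ?_)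
    rw [lintegral_mul_const _ (by fun_prop), ENNReal.ofReal_mul (by positivity)]
    gcongr
    exact h1 n
  filter_upwards [ae_lt_top (by fun_prop) h3] with x hx
  have h4 := ENNReal.summable_toReal hx.ne
  refine h4.congr fun n => ?_
  rw [ENNReal.toReal_mul, toReal_enorm, ENNReal.toReal_ofReal (by positivity)]

lemma ae_mem_range_coeff (hm : 0 < m) (T : ℝ≥0) :
    ∀ᵐ x ∂gaussianCoeff m T, x ∈ Set.range coeff := by
  -- Countably many radii tending to `1` suffice, so the exceptional null sets can be united.
  have h : ∀ᵐ x ∂gaussianCoeff m T, ∀ k : ℕ, Summable fun n => ‖x n‖ * (1 - 1 / (k + 1 : ℝ)) ^ n :=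
    ae_all_iff.2 fun k => ae_summable_gaussianCoeff hm T
      (sub_nonneg.2 (div_le_one_of_le₀ (by linarith [k.cast_nonneg (α := ℝ)]) (by positivity)))
      (sub_lt_self _ (by positivity))
  filter_upwards [h] with x hx
  refine mem_range_coeff x fun r hr0 hr1 => ?_
  obtain ⟨k, hk⟩ := exists_nat_one_div_lt (sub_pos.2 hr1)
  refine Summable.of_nonneg_of_le (fun n => by positivity) (fun n => ?_) (hx k)
  gcongr
  linarith

/-- Pulling back along `coeff` and pushing forward only restricts to the range, which has full
measure. -/
lemma map_coeff_gaussian (hm : 0 < m) (T : ℝ≥0) :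
    (gaussian m T).map coeff = gaussianCoeff m T := by
  have h : (gaussian m T).map coeff = (gaussianCoeff m T).restrict (Set.range coeff) :=
    measurableEmbedding_coeff.map_comap _
  rw [h]
  exact Measure.restrict_eq_self_of_ae_mem (ae_mem_range_coeff hm T)

lemma isProbabilityMeasure_gaussian (hm : 0 < m) (T : ℝ≥0) :
    IsProbabilityMeasure (gaussian m T) := by
  constructor
  have h := congrArg (fun μ => μ Set.univ) (map_coeff_gaussian hm T)
  simpa [Measure.map_apply continuous_coeff.measurable MeasurableSet.univ] using h

lemma charFun_map_const_mul {Ω : Type*} [MeasurableSpace Ω] {P : Measure Ω} {X : Ω → ℂ}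
    (hX : AEMeasurable X P) (a t : ℂ) :
    charFun (P.map fun ω => a * X ω) t = charFun (P.map X) (conj a * t) := by
  rw [charFun_apply, charFun_apply, integral_map (hX.const_mul a) (by fun_prop),
    integral_map hX (by fun_prop)]
  refine integral_congr_ae (Eventually.of_forall fun ω => ?_)
  simp only [Complex.inner, map_mul]
  congr 4
  ring

/-- The coordinates are independent, so the characteristic functions multiply and the variances add.
-/
lemma map_linComb_gaussian (hm : 0 < m) (T : ℝ≥0) (a : ℕ → ℂ) (N : ℕ) :
    (gaussian m T).map (linComb a N) =
      complexGaussian (∑ i ∈ Finset.range N, T / (weight m i).toNNReal * ‖a i‖₊ ^ 2) := by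
  have := isProbabilityMeasure_gaussian hm T
  have : IsProbabilityMeasure ((gaussian m T).map (linComb a N)) :=
    Measure.isProbabilityMeasure_map (measurable_linComb a N).aemeasurable
  have h1 : (gaussian m T).map (linComb a N) =
      (gaussianCoeff m T).map fun x => ∑ i ∈ Finset.range N, a i * x i := by
    rw [← map_coeff_gaussian hm, Measure.map_map (by fun_prop) continuous_coeff.measurable]
    rfl
  have hind : iIndepFun (fun i (x : ℕ → ℂ) => a i * x i) (gaussianCoeff m T) :=
    iIndepFun_infinitePi (X := fun i z => a i * z) fun i => by fun_prop
  refine Measure.ext_of_charFun (funext fun t => ?_)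
  rw [h1, iIndepFun.charFun_map_fun_finsetSum_eq_prod (X := fun i (x : ℕ → ℂ) => a i * x i)
    (fun i _ => ((measurable_pi_apply i).const_mul _).aemeasurable) (hind.restrict _), Finset.prod_apply,
    charFun_complexGaussian]
  have h2 : ∀ i, charFun ((gaussianCoeff m T).map fun x => a i * x i) t =
      Complex.exp (-(T / (weight m i).toNNReal * ‖a i‖₊ ^ 2 * ‖t‖ ^ 2 : ℝ) / 2) := fun i => by
    rw [charFun_map_const_mul (measurable_pi_apply i).aemeasurable, map_eval_gaussianCoeff, charFun_complexGaussian,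
      norm_mul, RCLike.norm_conj, mul_pow]
    push_cast
    simp only [mul_assoc]
  simp_rw [h2]
  rw [← Complex.exp_sum]
  congr 1
  push_cast
  rw [Finset.sum_mul, ← Finset.sum_div, ← Finset.sum_neg_distrib]

lemma isCentred_gaussian (hm : 0 < m) (T : ℝ≥0) (a : ℕ → ℂ) (N : ℕ) :
    IsCentred (gaussian m T) (linComb a N)
      (2 * T * ∑ i ∈ Finset.range N, (weight m i)⁻¹ * ‖a i‖ ^ 2) := by
  have hmeas := (measurable_linComb a N).aemeasurable (μ := gaussian m T)
  have hl := map_linComb_gaussian hm T a N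
  have h1 := memLp_complexGaussian (∑ i ∈ Finset.range N, T / (weight m i).toNNReal * ‖a i‖₊ ^ 2)
  have h2 := integral_complexGaussian
    (∑ i ∈ Finset.range N, T / (weight m i).toNNReal * ‖a i‖₊ ^ 2)
  have h3 := integral_norm_sq_complexGaussian
    (∑ i ∈ Finset.range N, T / (weight m i).toNNReal * ‖a i‖₊ ^ 2)
  rw [← hl] at h1 h2 h3
  rw [memLp_map_measure_iff (by fun_prop) hmeas] at h1
  rw [integral_map hmeas (by fun_prop)] at h2 h3
  refine ⟨h1, h2, h3.trans ?_⟩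
  rw [NNReal.coe_sum, mul_assoc, Finset.mul_sum (a := (T : ℝ))]
  congr 1
  refine Finset.sum_congr rfl fun i _ => ?_
  rw [NNReal.coe_mul, coe_div_weight hm, NNReal.coe_pow, coe_nnnorm, mul_assoc]

lemma charFun_map_linComb_gaussian (hm : 0 < m) (T : ℝ≥0) (a : ℕ → ℂ) (N : ℕ) (t : ℂ) :
    charFun ((gaussian m T).map (linComb a N)) t = Complex.exp (-(‖t‖ ^ 2 *
      (2 * T * ∑ i ∈ Finset.range N, (weight m i)⁻¹ * ‖a i‖ ^ 2) / 2 : ℝ) / 2) := by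
  rw [map_linComb_gaussian hm, charFun_complexGaussian, NNReal.coe_sum]
  congr 4
  simp_rw [NNReal.coe_mul, coe_div_weight hm, NNReal.coe_pow, coe_nnnorm, mul_assoc,
    ← Finset.mul_sum]
  ring

end Gaussian

/-! ### Versions of functionals under measures with bounded second moments -/

section Version

/-- The second moments of finite linear combinations of Taylor coefficients under `μ` are at most
`s` times the squared norms of the corresponding functionals on `H^m ∩ L²`. -/
def SecondMomentBound (m s : ℝ) (μ : Measure Hol) : Prop :=
  ∀ (a : ℕ → ℂ) (N : ℕ), MemLp (linComb a N) 2 μ ∧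
    ∫ f, ‖linComb a N f‖ ^ 2 ∂μ ≤ s * ∑ i ∈ Finset.range N, (weight m i)⁻¹ * ‖a i‖ ^ 2

lemma eLpNorm_two_eq {Ω : Type*} [MeasurableSpace Ω] {P : Measure Ω} {X : Ω → ℂ}
    (hX : MemLp X 2 P) : eLpNorm X 2 P = ENNReal.ofReal √(∫ ω, ‖X ω‖ ^ 2 ∂P) := by
  rw [hX.eLpNorm_eq_integral_rpow_norm two_ne_zero (by simp)]
  simp [Real.sqrt_eq_rpow]

/-- Writing a block of terms as a full combination with leading zeros lets `SecondMomentBound` apply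
to differences. -/
lemma linComb_sub_linComb (a : ℕ → ℂ) {N M : ℕ} (h : N ≤ M) :
    linComb a M - linComb a N = linComb (fun i => if i < N then 0 else a i) M := by
  funext f
  have h0 : ∑ i ∈ Finset.range N, (if i < N then 0 else a i) * coeff f i = 0 :=
    Finset.sum_eq_zero fun i hi => by rw [if_pos (Finset.mem_range.1 hi), zero_mul]
  simp only [Pi.sub_apply, linComb]
  rw [← Finset.sum_range_add_sum_Ico _ h, ← Finset.sum_range_add_sum_Ico _ h, add_sub_cancel_left,
    h0, zero_add]
  exact Finset.sum_congr rfl fun i hi => by rw [if_neg (not_lt.2 (Finset.mem_Ico.1 hi).1)]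

variable {m s : ℝ} {hm : 0 < m} {μ : Measure Hol}

/-- The squared norm of the part of `φ` of degree at least `N`. -/
def dualTail (φ : StrongDual ℂ (HL2 hm)) (N : ℕ) : ℝ :=
  ‖φ‖ ^ 2 - ∑ n ∈ Finset.range N, (weight m n)⁻¹ * ‖φ (HL2.monomial hm n)‖ ^ 2

lemma tendsto_sqrt_mul_dualTail (s : ℝ) (φ : StrongDual ℂ (HL2 hm)) :
    Tendsto (fun N => √(s * dualTail φ N)) atTop (𝓝 0) := by
  have h : Tendsto (fun N => dualTail φ N) atTop (𝓝 0) := by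
    rw [← sub_self (‖φ‖ ^ 2)]
    exact tendsto_const_nhds.sub (hasSum_norm_sq_dual φ).tendsto_sum_nat
  simpa using (h.const_mul s).sqrt

lemma SecondMomentBound.eLpNorm_sub_le (h : SecondMomentBound m s μ) (hs : 0 ≤ s)
    (φ : StrongDual ℂ (HL2 hm)) {N M : ℕ} (hNM : N ≤ M) :
    eLpNorm (partialEval φ M - partialEval φ N) 2 μ ≤ ENNReal.ofReal √(s * dualTail φ N) := by
  rw [partialEval_eq_linComb, partialEval_eq_linComb, linComb_sub_linComb _ hNM,
    eLpNorm_two_eq (h _ _).1]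
  refine ENNReal.ofReal_le_ofReal (Real.sqrt_le_sqrt ((h _ _).2.trans ?_))
  refine mul_le_mul_of_nonneg_left ?_ hs
  rw [dualTail, le_sub_iff_add_le']
  refine le_trans (le_of_eq ?_) (sum_norm_sq_dual_le φ M)
  rw [← Finset.sum_range_add_sum_Ico _ hNM, ← Finset.sum_range_add_sum_Ico _ hNM]
  congr 1
  rw [Finset.sum_eq_zero, zero_add]
  · exact Finset.sum_congr rfl fun i hi => by rw [if_neg (not_lt.2 (Finset.mem_Ico.1 hi).1)]
  · exact fun i hi => by rw [if_pos (Finset.mem_range.1 hi)]; simp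

/-- The partial evaluations are Cauchy in `L²`, and completeness gives the limit. The rate depends
on `s` and `φ` but not on `μ`, which later permits one `N` for all scaled convolutions. -/
lemma SecondMomentBound.exists_limit (h : SecondMomentBound m s μ) (hs : 0 ≤ s)
    (φ : StrongDual ℂ (HL2 hm)) :
    ∃ X : Hol → ℂ, MemLp X 2 μ ∧
      (∀ N, eLpNorm (X - partialEval φ N) 2 μ ≤ ENNReal.ofReal √(s * dualTail φ N)) ∧
      Tendsto (fun N => ∫ f, ‖partialEval φ N f‖ ^ 2 ∂μ) atTop (𝓝 (∫ f, ‖X f‖ ^ 2 ∂μ)) := by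
  have hp : ∀ N, MemLp (partialEval φ N) 2 μ := fun N => by
    rw [partialEval_eq_linComb]
    exact (h _ _).1
  set u : ℕ → Lp ℂ 2 μ := fun N => (hp N).toLp with hu
  have hd : ∀ N M, N ≤ M → dist (u M) (u N) ≤ √(s * dualTail φ N) := fun N M hNM => by
    rw [Lp.dist_def]
    refine ENNReal.toReal_le_of_le_ofReal (Real.sqrt_nonneg _) ?_
    refine le_trans (le_of_eq ?_) (h.eLpNorm_sub_le hs φ hNM)
    exact eLpNorm_congr_ae ((hp M).coeFn_toLp.sub (hp N).coeFn_toLp)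
  have hc : CauchySeq u := cauchySeq_of_le_tendsto_0' (fun N => √(s * dualTail φ N))
    (fun N M hNM => by rw [dist_comm]; exact hd N M hNM) (tendsto_sqrt_mul_dualTail s φ)
  obtain ⟨U, hU⟩ := cauchySeq_tendsto_of_complete hc
  refine ⟨U, Lp.memLp U, fun N => ?_, ?_⟩
  · have h1 : dist U (u N) ≤ √(s * dualTail φ N) :=
      le_of_tendsto (hU.dist tendsto_const_nhds)
        (eventually_atTop.2 ⟨N, fun M hM => hd N M hM⟩)
    rw [Lp.dist_def] at h1
    have h2 : eLpNorm (⇑U - partialEval φ N) 2 μ = eLpNorm (⇑U - ⇑(u N)) 2 μ :=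
      eLpNorm_congr_ae ((EventuallyEq.refl _ _).sub (hp N).coeFn_toLp.symm)
    rw [h2]
    refine ENNReal.le_ofReal_iff_toReal_le ?_ (Real.sqrt_nonneg _) |>.2 h1
    exact ((Lp.memLp U).sub (Lp.memLp (u N))).eLpNorm_ne_top
  · have h1 := (hU.norm).pow 2
    have h2 : ∀ (F : Hol → ℂ) (hF : MemLp F 2 μ), ‖hF.toLp‖ ^ 2 = ∫ f, ‖F f‖ ^ 2 ∂μ :=
      fun F hF => by
        rw [Lp.norm_toLp, eLpNorm_two_eq hF, ENNReal.toReal_ofReal (Real.sqrt_nonneg _),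
          Real.sq_sqrt (integral_nonneg fun f => sq_nonneg _)]
    simp_rw [hu, h2] at h1
    have h3 := h2 U (Lp.memLp U)
    rw [Lp.toLp_coeFn] at h3
    rwa [h3] at h1

lemma isVersion_of_eLpNorm_le [IsProbabilityMeasure μ] {φ : StrongDual ℂ (HL2 hm)} {X : Hol → ℂ}
    (hX : MemLp X 2 μ)
    (h : ∀ N, eLpNorm (X - partialEval φ N) 2 μ ≤ ENNReal.ofReal √(s * dualTail φ N)) :
    IsVersion μ φ X := by
  refine ⟨hX.1.aemeasurable, tendstoInMeasure_of_tendsto_eLpNorm two_ne_zero (fun N => ?_) hX.1 ?_⟩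
  · rw [partialEval_eq_linComb]
    exact (measurable_linComb _ _).aestronglyMeasurable
  · refine tendsto_of_tendsto_of_tendsto_of_le_of_le tendsto_const_nhds ?_ (fun _ => zero_le)
      fun N => (eLpNorm_sub_comm _ _ _ _).trans_le (h N)
    simpa using ENNReal.tendsto_ofReal (tendsto_sqrt_mul_dualTail s φ)

lemma IsVersion.ae_eq {φ : StrongDual ℂ (HL2 hm)} {X Y : Hol → ℂ} (hX : IsVersion μ φ X)
    (hY : IsVersion μ φ Y) : X =ᵐ[μ] Y :=
  tendstoInMeasure_ae_unique hX.2 hY.2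

lemma lintegral_enorm_le_eLpNorm [IsProbabilityMeasure μ] {X : Hol → ℂ}
    (hX : AEStronglyMeasurable X μ) : ∫⁻ f, ‖X f‖ₑ ∂μ ≤ eLpNorm X 2 μ := by
  rw [← eLpNorm_one_eq_lintegral_enorm]
  exact eLpNorm_le_eLpNorm_of_exponent_le one_le_two hX

lemma complexVariance_eq [IsProbabilityMeasure μ] {X : Hol → ℂ} (hX : MemLp X 2 μ)
    (h0 : ∫ f, X f ∂μ = 0) : complexVariance X μ = (∫ f, ‖X f‖ ^ 2 ∂μ) / 2 := by
  have hi : Integrable X μ := hX.integrable one_le_two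
  have hre : MemLp (fun f => (X f).re) 2 μ := hX.re
  have him : MemLp (fun f => (X f).im) 2 μ := hX.im
  have h1 : ∫ f, (X f).re ∂μ = 0 := by
    have : ∫ f, (X f).re ∂μ = (∫ f, X f ∂μ).re := integral_re hi
    rw [this, h0, Complex.zero_re]
  have h2 : ∫ f, (X f).im ∂μ = 0 := by
    have : ∫ f, (X f).im ∂μ = (∫ f, X f ∂μ).im := integral_im hi
    rw [this, h0, Complex.zero_im]
  rw [complexVariance, variance_of_integral_eq_zero hre.1.aemeasurable h1,
    variance_of_integral_eq_zero him.1.aemeasurable h2,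
    ← integral_add hre.integrable_sq him.integrable_sq]
  congr 1
  refine integral_congr_ae (Eventually.of_forall fun f => ?_)
  simp only [Complex.sq_norm, Complex.normSq_apply]
  ring

end Version

/-! ### Convergence in distribution by uniform approximation -/

section Approximation

lemma abs_integral_sub_le {Ω E : Type*} [MeasurableSpace Ω] [PseudoMetricSpace E]
    [MeasurableSpace E] [BorelSpace E] {P : Measure Ω} [IsProbabilityMeasure P] {X Z : Ω → E}
    (hX : AEMeasurable X P) (hZ : AEMeasurable Z P) {h : E → ℝ} {C : ℝ}
    (hC : ∀ x y, dist (h x) (h y) ≤ C) {K : ℝ≥0} (hK : LipschitzWith K h) {ε η : ℝ}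
    (hε : 0 ≤ ε) (hη : 0 ≤ η)
    (hP : P {ω | ε ≤ dist (X ω) (Z ω)} ≤ ENNReal.ofReal η) :
    |∫ x, h x ∂(P.map X) - ∫ x, h x ∂(P.map Z)| ≤ K * ε + C * η := by
  have hhm : Measurable h := hK.continuous.measurable
  have hbd : ∀ {W : Ω → E}, AEMeasurable W P → Integrable (fun ω => h (W ω)) P := fun {W} hW => by
    obtain ⟨ω₀⟩ : Nonempty Ω := P.nonempty_of_neZero
    refine Integrable.of_bound (hhm.comp_aemeasurable hW).aestronglyMeasurable
      (C + ‖h (X ω₀)‖) (Eventually.of_forall fun ω => ?_)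
    have h1 := hC (W ω) (X ω₀)
    rw [dist_eq_norm] at h1
    linarith [norm_sub_norm_le (h (W ω)) (h (X ω₀))]
  rw [integral_map hX hhm.aestronglyMeasurable, integral_map hZ hhm.aestronglyMeasurable,
    ← integral_sub (hbd hX) (hbd hZ), ← Real.norm_eq_abs]
  -- The exceptional set need not be measurable, so it is replaced by a measurable hull of equal
  -- measure. Off it the Lipschitz bound gives `K * ε`; on it the oscillation is at most `C`.
  set A := toMeasurable P {ω | ε ≤ dist (X ω) (Z ω)} with hA
  have hAm : MeasurableSet A := measurableSet_toMeasurable _ _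
  have hC0 : 0 ≤ C := by
    obtain ⟨ω₀⟩ : Nonempty Ω := P.nonempty_of_neZero
    simpa using hC (X ω₀) (X ω₀)
  have hle : ∀ ω, ‖h (X ω) - h (Z ω)‖ ≤ K * ε + A.indicator (fun _ => C) ω := fun ω => by
    rw [← dist_eq_norm]
    by_cases hω : ε ≤ dist (X ω) (Z ω)
    · have hωA : ω ∈ A := subset_toMeasurable P {ω | ε ≤ dist (X ω) (Z ω)} hω
      rw [Set.indicator_of_mem hωA]
      exact (hC _ _).trans (le_add_of_nonneg_left (by positivity))
    · refine (hK.dist_le_mul _ _).trans ?_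
      have h1 : 0 ≤ A.indicator (fun _ => C) ω := Set.indicator_nonneg (fun _ _ => hC0) _
      have h2 := mul_le_mul_of_nonneg_left (not_le.1 hω).le K.coe_nonneg
      linarith
  have hi : Integrable (A.indicator fun _ => C) P := (integrable_const C).indicator hAm
  calc ‖∫ ω, h (X ω) - h (Z ω) ∂P‖ ≤ ∫ ω, ‖h (X ω) - h (Z ω)‖ ∂P :=
        norm_integral_le_integral_norm _
    _ ≤ ∫ ω, K * ε + A.indicator (fun _ => C) ω ∂P :=
        integral_mono ((hbd hX).sub (hbd hZ)).norm ((integrable_const _).add hi) hle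
    _ = K * ε + C * P.real A := by
        rw [integral_add (integrable_const _) hi, integral_const, integral_indicator_const _ hAm,
          probReal_univ, one_smul, smul_eq_mul, mul_comm C]
    _ ≤ K * ε + C * η := by
        gcongr
        rw [measureReal_def, hA, measure_toMeasurable]
        exact ENNReal.toReal_le_of_le_ofReal hη hP

/-- A three-term estimate with Lipschitz test functions, the index `N` serving all `n` at once. The
pseudometric is an explicit argument because `E` comes with a topology and no preferred metric. -/
lemma tendstoInDistribution_of_approx {Ω E : Type*} [MeasurableSpace Ω] [t : TopologicalSpace E]
    [MeasurableSpace E] [BorelSpace E] (d : PseudoMetricSpace E)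
    (hd : d.toUniformSpace.toTopologicalSpace = t) {μ : ℕ → Measure Ω}
    [∀ n, IsProbabilityMeasure (μ n)] {μ' : Measure Ω} [IsProbabilityMeasure μ']
    {X : ℕ → Ω → E} {Y : Ω → E} {Z : ℕ → Ω → E} (hX : ∀ n, AEMeasurable (X n) (μ n))
    (hY : AEMeasurable Y μ')
    (hZ : ∀ N, TendstoInDistribution (fun _ : ℕ => Z N) atTop (Z N) μ μ')
    (happ : ∀ ε > 0, ∃ N, (∀ n, μ n {ω | ε ≤ dist (X n ω) (Z N ω)} ≤ ENNReal.ofReal ε) ∧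
      μ' {ω | ε ≤ dist (Y ω) (Z N ω)} ≤ ENNReal.ofReal ε) :
    TendstoInDistribution X atTop Y μ μ' := by
  subst hd
  refine ⟨hX, hY, tendsto_iff_forall_lipschitz_integral_tendsto.2 ?_⟩
  rintro h ⟨C, hC⟩ ⟨K, hK⟩
  have hC0 : 0 ≤ C := by
    obtain ⟨ω₀⟩ : Nonempty Ω := μ'.nonempty_of_neZero
    simpa using hC (Y ω₀) (Y ω₀)
  rw [Metric.tendsto_atTop]
  intro δ hδ
  -- Two approximation errors of at most `(K + C) * ε` and one convergence error below `ε`: each is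
  -- at most `δ / 3`.
  set ε := δ / (3 * (K + C + 1)) with hε
  have hKC : 0 < K + C + 1 := by positivity
  have hε0 : 0 < ε := by positivity
  obtain ⟨N, hN, hN'⟩ := happ ε hε0
  have hT := tendsto_iff_forall_lipschitz_integral_tendsto.1 (hZ N).tendsto
  obtain ⟨n₀, hn₀⟩ := Metric.tendsto_atTop.1 (hT h ⟨C, hC⟩ ⟨K, hK⟩) ε hε0
  refine ⟨n₀, fun n hn => ?_⟩
  have h1 := abs_integral_sub_le (hX n) ((hZ N).forall_aemeasurable n) hC hK hε0.le hε0.le (hN n)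
  have h2 := abs_integral_sub_le hY (hZ N).aemeasurable_limit hC hK hε0.le hε0.le hN'
  have h3 := hn₀ n hn
  rw [Real.dist_eq] at h3 ⊢
  simp only [ProbabilityMeasure.coe_mk] at h3 ⊢
  have h4 : (K + C + 1) * ε = δ / 3 := by
    rw [hε]
    field_simp
  rw [abs_le] at h1 h2
  rw [abs_lt] at h3 ⊢
  have h5 : K * ε + C * ε + ε = δ / 3 := by rw [← h4]; ring
  have h6 : 0 ≤ K * ε := by positivity
  have h7 : 0 ≤ C * ε := by positivity
  constructor <;> linarith

end Approximation

/-! ### Taylor polynomials -/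

section Taylor

variable {m s : ℝ}

/-- The polynomial with given coefficients, as an element of `Hol`. -/
def poly (N : ℕ) (x : EuclideanSpace ℂ (Fin N)) : Hol := ∑ i : Fin N, x i • monomial i

/-- The vector of the first `N` Taylor coefficients. -/
def coeffs (N : ℕ) (f : Hol) : EuclideanSpace ℂ (Fin N) := WithLp.toLp 2 fun i => coeff f i

lemma continuous_poly (N : ℕ) : Continuous (poly N) := by
  unfold poly
  fun_prop

@[fun_prop]
lemma measurable_coeffs (N : ℕ) : Measurable (coeffs N) :=
  (WithLp.measurable_toLp 2 _).comp (measurable_pi_lambda _ fun i => measurable_coeff_apply i)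

/-- The Taylor polynomial of degree less than `N`. -/
def taylorPoly (N : ℕ) (f : Hol) : Hol := poly N (coeffs N f)

lemma coeff_taylorPoly (N : ℕ) (f : Hol) (n : ℕ) :
    coeff (taylorPoly N f) n = if n < N then coeff f n else 0 := by
  simp only [taylorPoly, poly, coeffs, coeff_sum, coeff_smul, coeff_monomial]
  rw [Fin.sum_univ_eq_sum_range (fun i => coeff f i * if n = i then 1 else 0)]
  simp

lemma enorm_extend_sub_taylorPoly_le (N : ℕ) (f : Hol) {r : ℝ} (hr : r < 1) {z : ℂ}
    (hz : ‖z‖ ≤ r) : ‖extend f.1 z - extend (taylorPoly N f).1 z‖ₑ ≤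
      ∑' k, ENNReal.ofReal (r ^ (k + N)) * ‖coeff f (k + N)‖ₑ := by
  have hz1 : ‖z‖ < 1 := hz.trans_lt hr
  have h1 : extend (taylorPoly N f).1 z = ∑ i ∈ Finset.range N, coeff f i * z ^ i := by
    refine (hasSum_coeff _ hz1).unique ?_
    have h2 := hasSum_sum_of_ne_finset_zero (L := .unconditional ℕ) (s := Finset.range N)
      (f := fun n => coeff (taylorPoly N f) n * z ^ n) fun n hn => by
        rw [coeff_taylorPoly, if_neg (by simpa using hn), zero_mul]
    convert h2 using 1
    exact Finset.sum_congr rfl fun n hn => by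
      rw [coeff_taylorPoly, if_pos (Finset.mem_range.1 hn)]
  have h3 := (hasSum_nat_add_iff' N).2 (hasSum_coeff f hz1)
  rw [h1, ← h3.tsum_eq]
  refine (enorm_tsum_le_tsum_enorm).trans (ENNReal.tsum_le_tsum fun k => ?_)
  rw [enorm_mul, enorm_pow, mul_comm, ENNReal.ofReal_pow ((norm_nonneg z).trans hz)]
  gcongr
  rw [← ofReal_norm]
  exact ENNReal.ofReal_le_ofReal hz

lemma SecondMomentBound.lintegral_coeff_le {μ : Measure Hol} [IsProbabilityMeasure μ]
    (h : SecondMomentBound m s μ) (hs : 0 ≤ s) (n : ℕ) :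
    ∫⁻ f, ‖coeff f n‖ₑ ∂μ ≤ ENNReal.ofReal (√s * √(weight m n)⁻¹) := by
  have h1 : linComb (Pi.single n 1) (n + 1) = fun f => coeff f n := by
    funext f
    rw [linComb, Finset.sum_eq_single n]
    · simp
    · intro k _ hk
      simp [hk]
    · simp
  obtain ⟨h2, h3⟩ := h (Pi.single n 1) (n + 1)
  have h4 : ∑ i ∈ Finset.range (n + 1), (weight m i)⁻¹ * ‖(Pi.single n 1 : ℕ → ℂ) i‖ ^ 2 =
      (weight m n)⁻¹ := by
    rw [Finset.sum_eq_single n]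
    · simp
    · intro k _ hk
      simp [hk]
    · simp
  rw [h1] at h2
  rw [h1, h4] at h3
  refine (lintegral_enorm_le_sqrt h2).trans (ENNReal.ofReal_le_ofReal ?_)
  rw [← Real.sqrt_mul hs]
  exact Real.sqrt_le_sqrt h3

/-- No explicit formula for the metric is needed. Its only relevant property is that uniform
closeness on some disc `|z| ≤ r < 1` forces closeness, because each compact subset of the open disc
lies in such a disc. -/
lemma exists_pseudoMetricSpace : ∃ d : PseudoMetricSpace Hol,
    d.toUniformSpace.toTopologicalSpace = (inferInstance : TopologicalSpace Hol) ∧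
    ∀ ε > 0, ∃ δ > 0, ∃ r : ℝ, 0 ≤ r ∧ r < 1 ∧ ∀ f g : Hol,
      (∀ z : ℂ, ‖z‖ ≤ r → ‖extend f.1 z - extend g.1 z‖ < δ) → dist f g < ε := by
  let d₀ : PseudoMetricSpace C(Disc, ℂ) := UniformSpace.pseudoMetricSpace C(Disc, ℂ)
  refine ⟨d₀.induced fun f : Hol => (f.1 : C(Disc, ℂ)), rfl, fun ε hε => ?_⟩
  have h1 : {p : C(Disc, ℂ) × C(Disc, ℂ) | d₀.dist p.1 p.2 < ε} ∈ uniformity C(Disc, ℂ) :=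
    Metric.dist_mem_uniformity hε
  obtain ⟨K, V, hK, hV, hKV⟩ := (ContinuousMap.mem_compactConvergence_entourage_iff _).1 h1
  obtain ⟨δ, hδ, hδV⟩ := Metric.mem_uniformity_dist.1 hV
  have hr : ∃ r : ℝ, 0 ≤ r ∧ r < 1 ∧ ∀ z ∈ K, ‖(z : ℂ)‖ ≤ r := by
    rcases K.eq_empty_or_nonempty with rfl | hne
    · exact ⟨0, le_rfl, one_pos, by simp⟩
    · obtain ⟨z, _, hz⟩ := hK.exists_isMaxOn hne
        (f := fun z : Disc => ‖(z : ℂ)‖) (by fun_prop)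
      exact ⟨‖(z : ℂ)‖, norm_nonneg _, mem_ball_zero_iff.1 z.2, fun w hw => hz hw⟩
  obtain ⟨r, hr0, hr1, hrK⟩ := hr
  refine ⟨δ, hδ, r, hr0, hr1, fun f g hfg => ?_⟩
  refine hKV (a := (f.1, g.1)) fun z hz => hδV ?_
  rw [dist_eq_norm, ← extend_coe, ← extend_coe]
  exact hfg z (hrK z hz)

/-- The expected tail is dominated by the tail of a convergent series independent of `μ`. Taking `N`
with that tail at most `δ * η`, Markov's inequality leaves `η`. -/
lemma exists_taylorPoly_approx (hm : 0 < m) (hs : 0 ≤ s) {δ η r : ℝ} (hδ : 0 < δ) (hη : 0 < η)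
    (hr0 : 0 ≤ r) (hr : r < 1) : ∃ N, ∀ (μ : Measure Hol) [IsProbabilityMeasure μ],
      SecondMomentBound m s μ →
        μ {f | ENNReal.ofReal δ ≤ ∑' k, ENNReal.ofReal (r ^ (k + N)) * ‖coeff f (k + N)‖ₑ} ≤
          ENNReal.ofReal η := by
  have hsum : Summable fun n => r ^ n * (√s * √(weight m n)⁻¹) :=
    ((summable_sqrt_inv_weight hm hr0 hr).mul_left √s).congr fun n => by ring
  have ht := ENNReal.tendsto_sum_nat_add _ hsum.tsum_ofReal_ne_top
  have hpos : 0 < ENNReal.ofReal δ * ENNReal.ofReal η :=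
    ENNReal.mul_pos (by simpa) (by simpa)
  obtain ⟨N, hN⟩ := (ht.eventually (ge_mem_nhds hpos)).exists
  refine ⟨N, fun μ _ h => ?_⟩
  have hmeas : Measurable fun f => ∑' k, ENNReal.ofReal (r ^ (k + N)) * ‖coeff f (k + N)‖ₑ :=
    Measurable.tsum fun k => by fun_prop
  have h1 := mul_meas_ge_le_lintegral (μ := μ) hmeas (ENNReal.ofReal δ)
  rw [lintegral_tsum fun k => by fun_prop] at h1
  have h2 : ∑' k, ∫⁻ f, ENNReal.ofReal (r ^ (k + N)) * ‖coeff f (k + N)‖ₑ ∂μ ≤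
      ENNReal.ofReal δ * ENNReal.ofReal η := by
    refine le_trans (ENNReal.tsum_le_tsum fun k => ?_) hN
    rw [lintegral_const_mul _ (by fun_prop), ENNReal.ofReal_mul (by positivity)]
    gcongr
    exact h.lintegral_coeff_le hs _
  exact (ENNReal.mul_le_mul_iff_right (by simpa) ENNReal.ofReal_ne_top).1 (h1.trans h2)

end Taylor

/-! ### The limit theorem -/

section Limit

variable {m : ℝ} {hm : 0 < m} {ν : Measure Hol} [IsProbabilityMeasure ν] {T : ℝ≥0}

/-- Every real functional of the coefficient vector is the real part of one complex combination, so
the scalar limit theorem covers the joint law. -/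
lemma inner_coeffs (N : ℕ) (f : Hol) (t : EuclideanSpace ℂ (Fin N)) :
    inner ℝ (coeffs N f) t =
      inner ℝ (linComb (fun i => if h : i < N then conj (t ⟨i, h⟩) else 0) N f) (1 : ℂ) := by
  rw [PiLp.inner_apply, Complex.inner, one_mul, Complex.conj_re, linComb, Finset.sum_range,
    Complex.re_sum]
  refine Finset.sum_congr rfl fun i _ => ?_
  rw [dif_pos i.2, Complex.inner]
  simp [coeffs, Complex.mul_re]

lemma charFun_map_coeffs (μ : Measure Hol) (N : ℕ) (t : EuclideanSpace ℂ (Fin N)) :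
    charFun (μ.map (coeffs N)) t =
      charFun (μ.map (linComb (fun i => if h : i < N then conj (t ⟨i, h⟩) else 0) N)) 1 := by
  rw [charFun_apply, charFun_apply, integral_map (by fun_prop) (by fun_prop),
    integral_map (by fun_prop) (by fun_prop)]
  simp_rw [inner_coeffs]

/-- The hypotheses of the limit theorem: finite linear combinations of Taylor coefficients are
centred with the second moments of `gaussian m T`, and circularly symmetric to second order. -/
structure HasGaussianCov (m : ℝ) (T : ℝ≥0) (ν : Measure Hol) : Prop where
  isCentred : ∀ (a : ℕ → ℂ) (N : ℕ), IsCentred ν (linComb a N)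
    (2 * T * ∑ i ∈ Finset.range N, (weight m i)⁻¹ * ‖a i‖ ^ 2)
  integral_sq : ∀ (a : ℕ → ℂ) (N : ℕ), ∫ f, linComb a N f ^ 2 ∂ν = 0

lemma secondMomentBound_scaledConv (hm : 0 < m) (h : HasGaussianCov m T ν) (n : ℕ) :
    SecondMomentBound m (2 * T) (scaledConv ν n) := fun a N => by
  have h1 := (h.isCentred a N).scaledConv (measurable_linComb a N) (linComb_add a N)
    (linComb_smul a N) n
  refine ⟨h1.memLp, h1.integral_norm_sq.trans_le ?_⟩
  have h2 : 0 ≤ 2 * T * ∑ i ∈ Finset.range N, (weight m i)⁻¹ * ‖a i‖ ^ 2 :=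
    mul_nonneg (by positivity) (Finset.sum_nonneg fun i _ =>
      mul_nonneg (inv_pos.2 (weight_pos hm i)).le (sq_nonneg _))
  rw [← mul_assoc, inv_pow, Real.sq_sqrt n.cast_nonneg]
  -- The factor `n⁻¹ * n` is `1` except at `n = 0`, where it is `0`; hence the bound is an
  -- inequality.
  exact mul_le_of_le_one_left h2 inv_mul_le_one

lemma secondMomentBound_gaussian (hm : 0 < m) (T : ℝ≥0) :
    SecondMomentBound m (2 * T) (gaussian m T) := fun a N =>
  ⟨(isCentred_gaussian hm T a N).memLp, (isCentred_gaussian hm T a N).integral_norm_sq.le⟩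

lemma tendstoInDistribution_coeffs (hm : 0 < m) (h : HasGaussianCov m T ν)
    [IsProbabilityMeasure (gaussian m T)] (N : ℕ) :
    TendstoInDistribution (fun _ : ℕ => coeffs N) atTop (coeffs N) (scaledConv ν)
      (gaussian m T) := by
  refine ⟨fun n => by fun_prop, by fun_prop,
    ProbabilityMeasure.tendsto_iff_tendsto_charFun.2 fun t => ?_⟩
  simp only [ProbabilityMeasure.coe_mk, charFun_map_coeffs]
  rw [charFun_map_linComb_gaussian hm]
  exact tendsto_charFun_scaledConv (measurable_linComb _ N) (linComb_add _ N) (linComb_smul _ N)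
    (h.isCentred _ N) (h.integral_sq _ N) 1

lemma tendsto_scaledConv (hm : 0 < m) (h : HasGaussianCov m T ν)
    [hG : IsProbabilityMeasure (gaussian m T)] :
    Tendsto (β := ProbabilityMeasure Hol) (fun n : ℕ => ⟨scaledConv ν n, inferInstance⟩) atTop
      (𝓝 ⟨gaussian m T, hG⟩) := by
  obtain ⟨d, hd, hd'⟩ := exists_pseudoMetricSpace
  have key : TendstoInDistribution (fun _ : ℕ => (id : Hol → Hol)) atTop id (scaledConv ν)
      (gaussian m T) := by
    refine tendstoInDistribution_of_approx d hd (Z := taylorPoly) (fun n => aemeasurable_id)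
      aemeasurable_id (fun N => ?_) fun ε hε => ?_
    · exact (tendstoInDistribution_coeffs hm h N).continuous_comp (continuous_poly N)
    · obtain ⟨δ, hδ, r, hr0, hr1, hr⟩ := hd' ε hε
      obtain ⟨N, hN⟩ := exists_taylorPoly_approx hm (s := 2 * T) (by positivity) hδ hε hr0 hr1
      have hsub : {f : Hol | ε ≤ dist f (taylorPoly N f)} ⊆
          {f | ENNReal.ofReal δ ≤ ∑' k, ENNReal.ofReal (r ^ (k + N)) * ‖coeff f (k + N)‖ₑ} := by
        intro f hf
        by_contra hlt
        refine (not_lt.2 hf) (hr f _ fun z hz => ?_)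
        have h1 := (enorm_extend_sub_taylorPoly_le N f hr1 hz).trans_lt (not_le.1 hlt)
        rwa [← ofReal_norm, ENNReal.ofReal_lt_ofReal_iff hδ] at h1
      exact ⟨N, fun n => (measure_mono hsub).trans (hN _ (secondMomentBound_scaledConv hm h n)),
        (measure_mono hsub).trans (hN _ (secondMomentBound_gaussian hm T))⟩
  have h2 := key.tendsto
  simpa only [Measure.map_id] using h2

/-- Since `φ` need not extend continuously to `Hol`, weak convergence there does not suffice. The
partial evaluations approximate the versions uniformly in `n` instead. -/
lemma exists_tendstoInDistribution (h : HasGaussianCov m T ν)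
    [IsProbabilityMeasure (gaussian m T)] (φ : StrongDual ℂ (HL2 hm)) :
    ∃ (X : ℕ → Hol → ℂ) (Y : Hol → ℂ), (∀ n, IsVersion (scaledConv ν n) φ (X n)) ∧
      IsVersion (gaussian m T) φ Y ∧
      TendstoInDistribution X atTop Y (scaledConv ν) (gaussian m T) := by
  have hs : (0 : ℝ) ≤ 2 * T := by positivity
  choose X hX hXt _ using fun n => (secondMomentBound_scaledConv hm h n).exists_limit hs φ
  obtain ⟨Y, hY, hYt, _⟩ := (secondMomentBound_gaussian hm T).exists_limit hs φ
  refine ⟨X, Y, fun n => isVersion_of_eLpNorm_le (hX n) (hXt n), isVersion_of_eLpNorm_le hY hYt, ?_⟩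
  refine tendstoInDistribution_of_approx inferInstance rfl (Z := partialEval φ)
    (fun n => (hX n).1.aemeasurable) hY.1.aemeasurable (fun N => ?_) fun ε hε => ?_
  · have hc : Continuous fun x : EuclideanSpace ℂ (Fin N) =>
        ∑ i : Fin N, φ (HL2.monomial hm i) * x i := by fun_prop
    have h1 : partialEval φ N =
        (fun x : EuclideanSpace ℂ (Fin N) => ∑ i : Fin N, φ (HL2.monomial hm i) * x i) ∘ coeffs N := by
      funext f
      rw [partialEval_eq_linComb, linComb, Finset.sum_range]
      rfl
    rw [h1]
    exact (tendstoInDistribution_coeffs hm h N).continuous_comp hc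
  · have ht := tendsto_sqrt_mul_dualTail (2 * T) φ
    -- An `L²` error of at most `ε * ε` becomes probability at most `ε` of deviating by `ε`, by
    -- Markov.
    obtain ⟨N, hN⟩ := (ht.eventually (ge_mem_nhds (mul_pos hε hε))).exists
    have hgen : ∀ (μ : Measure Hol) [IsProbabilityMeasure μ] (F : Hol → ℂ), MemLp F 2 μ →
        eLpNorm (F - partialEval φ N) 2 μ ≤ ENNReal.ofReal √(2 * T * dualTail φ N) →
        μ {f | ε ≤ dist (F f) (partialEval φ N f)} ≤ ENNReal.ofReal ε := by
      intro μ _ F hF hle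
      have hmeas : AEStronglyMeasurable (F - partialEval φ N) μ := by
        rw [partialEval_eq_linComb]
        exact hF.1.sub (measurable_linComb _ _).aestronglyMeasurable
      have h1 := mul_meas_ge_le_lintegral₀ (μ := μ) hmeas.enorm (ENNReal.ofReal ε)
      have h2 := (h1.trans (lintegral_enorm_le_eLpNorm hmeas)).trans
        (hle.trans (ENNReal.ofReal_le_ofReal hN))
      rw [ENNReal.ofReal_mul hε.le] at h2
      have h3 := (ENNReal.mul_le_mul_iff_right (by simpa) ENNReal.ofReal_ne_top).1 h2
      refine (measure_mono fun f hf => ?_).trans h3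
      rw [Set.mem_ofPred_eq, dist_eq_norm] at hf
      rw [Set.mem_ofPred_eq, Pi.sub_apply, ← ofReal_norm]
      exact ENNReal.ofReal_le_ofReal hf
    exact ⟨N, fun n => hgen _ _ (hX n) (hXt n N), hgen _ _ hY (hYt N)⟩

lemma hasGaussianCov_of_isInvariant (hm : 0 < m) (hinv : IsInvariant m ν)
    (h2 : ∀ n, MemLp (fun f => coeff f n) 2 ν) (hT : 2 * (T : ℝ) = ∫ f, ‖coeff f 0‖ ^ 2 ∂ν) :
    HasGaussianCov m T ν where
  isCentred a N := ⟨memLp_linComb h2 a N, integral_linComb hm hinv h2 a N, by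
    rw [integral_norm_sq_linComb hm hinv h2, hT]⟩
  integral_sq := integral_linComb_sq hm hinv h2

lemma HasGaussianCov.secondMomentBound {μ : Measure Hol} (h : HasGaussianCov m T μ) :
    SecondMomentBound m (2 * T) μ := fun a N =>
  ⟨(h.isCentred a N).memLp, (h.isCentred a N).integral_norm_sq.le⟩

lemma HasGaussianCov.exists_isVersion (h : HasGaussianCov m T ν) (φ : StrongDual ℂ (HL2 hm)) :
    ∃ X : Hol → ℂ, IsVersion ν φ X ∧ complexVariance X ν = T * ‖φ‖ ^ 2 := by
  obtain ⟨X, hX, hXt, hX2⟩ := h.secondMomentBound.exists_limit (by positivity) φ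
  refine ⟨X, isVersion_of_eLpNorm_le hX hXt, ?_⟩
  -- The partial evaluations are centred, so the mean of `X` is bounded by its `L²` distance to each
  -- of them.
  have h0 : ∫ f, X f ∂ν = 0 := by
    have h1 : ∀ N, ‖∫ f, X f ∂ν‖ₑ ≤ ENNReal.ofReal √(2 * T * dualTail φ N) := fun N => by
      have hp := h.isCentred (fun n => φ (HL2.monomial hm n)) N
      rw [← partialEval_eq_linComb] at hp
      have h3 : ∫ f, X f ∂ν = ∫ f, (X - partialEval φ N) f ∂ν := by
        simp only [Pi.sub_apply]
        rw [integral_sub (hX.integrable one_le_two) (hp.memLp.integrable one_le_two),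
          hp.integral_eq_zero, sub_zero]
      rw [h3]
      exact (enorm_integral_le_lintegral_enorm _).trans
        ((lintegral_enorm_le_eLpNorm (hX.sub hp.memLp).1).trans (hXt N))
    have h4 : Tendsto (fun N => ENNReal.ofReal √(2 * T * dualTail φ N)) atTop (𝓝 0) := by
      simpa using ENNReal.tendsto_ofReal (tendsto_sqrt_mul_dualTail (2 * T) φ)
    have h5 := ge_of_tendsto' h4 h1
    simpa using h5
  rw [complexVariance_eq hX h0]
  have h6 : ∫ f, ‖X f‖ ^ 2 ∂ν = 2 * T * ‖φ‖ ^ 2 := by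
    refine tendsto_nhds_unique hX2 ?_
    have h7 : ∀ N, ∫ f, ‖partialEval φ N f‖ ^ 2 ∂ν = 2 * T *
        ∑ i ∈ Finset.range N, (weight m i)⁻¹ * ‖φ (HL2.monomial hm i)‖ ^ 2 := fun N => by
      rw [partialEval_eq_linComb]
      exact (h.isCentred _ N).integral_norm_sq
    simp_rw [h7]
    exact (hasSum_norm_sq_dual φ).tendsto_sum_nat.const_mul _
  rw [h6]
  ring

end Limit

end HolDiff

end

/-! ### The proposition -/

theorem mainTheorem7 {m : ℝ} (hm : 0 < m)
    (ν : Measure HolDiff.Hol) [IsProbabilityMeasure ν] (hinv : HolDiff.IsInvariant m ν)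
    (hvar : ∀ (φ : StrongDual ℂ (HolDiff.HL2 hm)) (X : HolDiff.Hol → ℂ),
      HolDiff.IsVersion ν φ X → MemLp X 2 ν) :
    (∀ φ : StrongDual ℂ (HolDiff.HL2 hm), ∃ X : HolDiff.Hol → ℂ, HolDiff.IsVersion ν φ X) ∧
    ∃ T : ℝ≥0,
      (∀ (φ : StrongDual ℂ (HolDiff.HL2 hm)) (X : HolDiff.Hol → ℂ), ‖φ‖ = 1 →
        HolDiff.IsVersion ν φ X → HolDiff.complexVariance X ν = T) ∧
      ∃ hG : IsProbabilityMeasure (HolDiff.gaussian m T),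
        Tendsto (β := ProbabilityMeasure HolDiff.Hol)
          (fun n : ℕ => ⟨HolDiff.scaledConv ν n, inferInstance⟩) atTop
          (𝓝 ⟨HolDiff.gaussian m T, hG⟩) ∧
        ∀ φ : StrongDual ℂ (HolDiff.HL2 hm), ∃ (X : ℕ → HolDiff.Hol → ℂ) (Y : HolDiff.Hol → ℂ),
          (∀ n, HolDiff.IsVersion (HolDiff.scaledConv ν n) φ (X n)) ∧
          HolDiff.IsVersion (HolDiff.gaussian m T) φ Y ∧
          TendstoInDistribution X atTop Y (HolDiff.scaledConv ν) (HolDiff.gaussian m T) := by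
  have h2 : ∀ n, MemLp (fun f => HolDiff.coeff f n) 2 ν := fun n =>
    hvar _ _ (HolDiff.isVersion_coeffDual (hm := hm) ν n)
  -- Since `w_0 = 1`, this is the variance of `f_0` per real dimension.
  let T : ℝ≥0 := ⟨(∫ f, ‖HolDiff.coeff f 0‖ ^ 2 ∂ν) / 2,
    div_nonneg (integral_nonneg fun f => sq_nonneg _) zero_le_two⟩
  have hcov : HolDiff.HasGaussianCov m T ν :=
    HolDiff.hasGaussianCov_of_isInvariant hm hinv h2 (mul_div_cancel₀ _ two_ne_zero)
  have hG := HolDiff.isProbabilityMeasure_gaussian hm T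
  refine ⟨fun φ => ?_, T, fun φ X hφ hX => ?_, hG, HolDiff.tendsto_scaledConv hm hcov,
    fun φ => HolDiff.exists_tendstoInDistribution hcov φ⟩
  · obtain ⟨X, hX, _⟩ := hcov.exists_isVersion φ
    exact ⟨X, hX⟩
  · obtain ⟨Y, hY, hvarY⟩ := hcov.exists_isVersion φ
    -- Limits in probability are almost everywhere unique, so an arbitrary version inherits the
    -- variance of the `L²` limit.
    have hXY := hX.ae_eq hY
    rw [hφ, one_pow, mul_one] at hvarY
    rw [← hvarY, HolDiff.complexVariance, HolDiff.complexVariance,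
      variance_congr (hXY.mono fun f hf => congrArg Complex.re hf),
      variance_congr (hXY.mono fun f hf => congrArg Complex.im hf)]
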